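/- Let $F$ be a nontrivial free group, of finite or infinite rank, and let $x\in F$. An element of $F$ is called primitive if it belongs to some free basis of $F$, and $|y|_p$ denotes the least number of primitive elements whose product is $y$. An Aut-norm on $F$ is the word norm of a generating set of the form $\{\psi(s): s\in S\cup S^{-1},\ \psi\in\mathrm{Aut}(F)\}$ with $S\subset F$ finite; any two such norms are bi-Lipschitz equivalent, and $|\cdot|_p$ is one of them. Call $x$ separable if it is conjugate to an element of a proper free factor of $F$, that is, if $F=F_1*F_2$ with $F_2\neq 1$ and $x$ is conjugate into $F_1$. Call $x$ undistorted in a norm $|\cdot|$ if there is $C>0$ such that $|x^n|>Cn$ for all $n\ge 1$. For a free basis $B$ of $F$ and $w,y\in F$ let $C_w(y)$ be the number of (possibly overlapping) occurrences of the reduced word of $w$ in $B$ as a subword of the reduced word of $y$ in $B$, and let $Br_w(y)=C_w(y)-C_w(y^{-1})$. Then exactly one of the following holds. a) $x$ is separable. In this case $|x^n|_p\le 2$ for all $n\in\mathbb Z$, and the cyclic subgroup $\langle x\rangle$ is bounded in every Aut-norm. b) $x$ is not separable. In this case $x$ is undistorted in the primitive norm and in every Aut-norm. Moreover there is a homogeneous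 quasimorphism $q\colon F\to\mathbb R$ that is bounded on the set of all primitive elements and satisfies $q(x)\neq 0$; namely, there is a free basis $B$ of $F$ in which $x$ is cyclically reduced such that the homogenization $q(y)=\lim_{n\to\infty}Br_{x^2}(y^n)/n$ of the Brooks counting function $Br_{x^2}$ with respect to $B$ exists and has these properties. -/

import Mathlib

namespace AutNorm

universe u

/-- The word norm of `x` with respect to `S`: the least `n` such that `x` is a product of `n`
elements of `S`. -/
noncomputable def wordNorm {G : Type u} [Group G] (S : Set G) (x : G) : ℕ :=
  sInf {n : ℕ | ∃ l : List G, (∀ s ∈ l, s ∈ S) ∧ l.prod = x ∧ l.length = n}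

/-- The set `{ψ(s) | s ∈ S ∪ S⁻¹, ψ ∈ Aut(G)}`. -/
def autOrbit {G : Type u} [Group G] (S : Set G) : Set G :=
  {g | ∃ ψ : MulAut G, ∃ s : G, (s ∈ S ∨ s⁻¹ ∈ S) ∧ g = ψ s}

/-- `N` is one of the (mutually bi-Lipschitz equivalent) norms that represent the Aut-norm of `G`:
the word norm of a generating set consisting of the `Aut(G)`-orbits of the elements of a finite set
and of their inverses. -/
def IsAutNorm {G : Type u} [Group G] (N : G → ℕ) : Prop :=
  ∃ S : Set G, S.Finite ∧ Subgroup.closure (autOrbit S) = ⊤ ∧ N = wordNorm (autOrbit S)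

/-- An element of a free group is primitive if it belongs to some free basis. -/
def IsPrimitive {F : Type u} [Group F] (p : F) : Prop :=
  ∃ (ι : Type u) (B : FreeGroupBasis ι F) (i : ι), B i = p

/-- The primitive norm. -/
noncomputable def primitiveNorm {F : Type u} [Group F] (x : F) : ℕ :=
  wordNorm {p : F | IsPrimitive p} x

/-- The subgroup `⟨x⟩` is bounded in the norm `N`. -/
def IsBoundedIn {G : Type u} [Group G] (N : G → ℕ) (x : G) : Prop :=
  ∃ C : ℕ, ∀ y ∈ Subgroup.zpowers x, N y ≤ C

/-- `x` is undistorted with respect to `N`: the norm of `x ^ n` grows at least linearly. -/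
def IsUndistorted {G : Type u} [Group G] (N : G → ℕ) (x : G) : Prop :=
  ∃ C : ℝ, 0 < C ∧ ∀ n : ℕ, 0 < n → C * (n : ℝ) < (N (x ^ n) : ℝ)

/-- `H` is a free factor of `F`: the group `F` is the internal free product of `H` and of some
subgroup `K`. -/
def IsFreeFactor {F : Type u} [Group F] (H : Subgroup F) : Prop :=
  ∃ K : Subgroup F, Function.Bijective (Monoid.Coprod.lift H.subtype K.subtype)

/-- `x` is separable: it is conjugate into a proper free factor. -/
def IsSeparable {F : Type u} [Group F] (x : F) : Prop :=
  ∃ H : Subgroup F, IsFreeFactor H ∧ H ≠ ⊤ ∧ ∃ g : F, g * x * g⁻¹ ∈ H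

/-- Quasimorphisms. -/
def IsQuasimorphism {G : Type u} [Group G] (q : G → ℝ) : Prop :=
  ∃ D : ℝ, ∀ a b : G, |q a - q (a * b) + q b| < D

/-- Homogeneous quasimorphisms. -/
def IsHomogeneousQuasimorphism {G : Type u} [Group G] (q : G → ℝ) : Prop :=
  IsQuasimorphism q ∧ ∀ (x : G) (n : ℤ), q (x ^ n) = (n : ℝ) * q x

/-- `r` is the homogenization of `q`, that is, `r a = lim q (a ^ n) / n` for all `a`. -/
def IsHomogenization {G : Type u} [Group G] (q r : G → ℝ) : Prop :=
  ∀ a : G, Filter.Tendsto (fun n : ℕ => q (a ^ n) / (n : ℝ)) Filter.atTop (nhds (r a))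

open Classical in
/-- The reduced word that expresses `x` in the free basis `B`. -/
noncomputable def reducedWord {F : Type u} [Group F] {ι : Type u} (B : FreeGroupBasis ι F) (x : F) :
    List (ι × Bool) :=
  (B.repr x).toWord

open Classical in
/-- The number of (possibly overlapping) occurrences of the word `w` as a subword of `l`, counted
by the positions where they start. -/
noncomputable def occurrences {α : Type u} (w l : List α) : ℕ :=
  l.tails.countP (fun t => decide (w <+: t))

/-- The Brooks counting function `Br_w(x) = C_w(x) - C_w(x⁻¹)` with respect to the basis `B`. -/
noncomputable def brooks {F : Type u} [Group F] {ι : Type u} (B : FreeGroupBasis ι F) (w x : F) : ℝ :=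
  (occurrences (reducedWord B w) (reducedWord B x) : ℝ) -
    (occurrences (reducedWord B w) (reducedWord B x⁻¹) : ℝ)

end AutNorm

/-!
All Aut-norms are bi-Lipschitz equivalent and the primitive norm is one of them, so only the
primitive norm matters. If `x` is conjugate into a proper free factor, some element `b` of a basis
is not needed to write a conjugate `y` of `x`; then `y ^ n * b` is primitive, and
`y ^ n = (y ^ n * b) * b⁻¹` is a product of two primitive elements.

If `x` is not separable, choose a basis in which the word of `x` is shortest among its images under
automorphisms. This word is cyclically reduced and involves every basis element, so the rank is
finite. The homogenization `q` of the Brooks function of `x ^ 2` satisfies `1 ≤ q x`, because the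
word of `x` never occurs in a power of its inverse. For `q` to vanish on the primitive elements (in
rank at least two) it suffices that `x ^ 2` does not occur in a power of a cyclically reduced
primitive element `c`. This is Whitehead's cut vertex lemma, proved with ends: the group has a
subset `A`, infinite and co-infinite, that is invariant under right translation by `c` and almost
invariant under all other right translations. At a deepest cone of the Cayley tree split by `A`,
membership in `A` near infinity cuts the alphabet into two parts, with at most one exceptional
letter, and every pair of consecutive letters of `c` respects the cut. If `x ^ 2` occurred in a
power of `c`, then so would the cyclic word of `x`, and the corresponding Whitehead automorphism
would shorten it.
-/

namespace AutNorm

universe u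

section WordNorm

variable {G : Type u} [Group G] {S T : Set G}

theorem wordNorm_list_prod_le {l : List G} (hl : ∀ s ∈ l, s ∈ S) : wordNorm S l.prod ≤ l.length :=
  Nat.sInf_le ⟨l, hl, rfl, rfl⟩

theorem exists_list_length_eq_wordNorm (hS : Submonoid.closure S = ⊤) (x : G) :
    ∃ l : List G, (∀ s ∈ l, s ∈ S) ∧ l.prod = x ∧ l.length = wordNorm S x := by
  obtain ⟨l, hl, hx⟩ := Submonoid.exists_list_of_mem_closure (hS ▸ Submonoid.mem_top x)
  exact Nat.sInf_mem (s := {n | ∃ l : List G, (∀ s ∈ l, s ∈ S) ∧ l.prod = x ∧ l.length = n})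
    ⟨_, l, hl, hx, rfl⟩

theorem wordNorm_mul_le (hS : Submonoid.closure S = ⊤) (x y : G) :
    wordNorm S (x * y) ≤ wordNorm S x + wordNorm S y := by
  obtain ⟨l, hl, rfl, h⟩ := exists_list_length_eq_wordNorm hS x
  obtain ⟨m, hm, rfl, h'⟩ := exists_list_length_eq_wordNorm hS y
  rw [← h, ← h', ← List.length_append, ← List.prod_append]
  exact wordNorm_list_prod_le (List.forall_mem_append.2 ⟨hl, hm⟩)

theorem wordNorm_map_le (hS : Submonoid.closure S = ⊤) {ψ : MulAut G} (hψ : ∀ s ∈ S, ψ s ∈ S)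
    (x : G) : wordNorm S (ψ x) ≤ wordNorm S x := by
  obtain ⟨l, hl, rfl, h⟩ := exists_list_length_eq_wordNorm hS x
  rw [← h, ← List.length_map (as := l) ψ, map_list_prod]
  exact wordNorm_list_prod_le (List.forall_mem_map.2 fun s hs => hψ s (hl s hs))

theorem wordNorm_le_mul_wordNorm (hS : Submonoid.closure S = ⊤) (hT : Submonoid.closure T = ⊤)
    {M : ℕ} (hM : ∀ s ∈ S, wordNorm T s ≤ M) (x : G) : wordNorm T x ≤ M * wordNorm S x := by
  obtain ⟨l, hl, rfl, h⟩ := exists_list_length_eq_wordNorm hS x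
  calc wordNorm T l.prod ≤ (l.map (wordNorm T)).sum :=
        List.apply_prod_le_sum_map l (wordNorm T) (wordNorm_list_prod_le (l := []) (by simp))
          (wordNorm_mul_le hT)
    _ ≤ (l.map (wordNorm T)).length • M :=
        List.sum_le_card_nsmul _ _ (List.forall_mem_map.2 fun s hs => hM s (hl s hs))
    _ = M * wordNorm S l.prod := by rw [List.length_map, h, smul_eq_mul, mul_comm]

theorem submonoidClosure_eq_top_of_inv_mem (hinv : ∀ s ∈ S, s⁻¹ ∈ S)
    (hS : Subgroup.closure S = ⊤) : Submonoid.closure S = ⊤ := by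
  have h : S⁻¹ ⊆ S := fun s hs => inv_inv s ▸ hinv _ hs
  rw [← Set.union_eq_self_of_subset_right h, ← Subgroup.closure_toSubmonoid, hS]
  rfl

theorem inv_mem_autOrbit {g : G} (hg : g ∈ autOrbit S) : g⁻¹ ∈ autOrbit S := by
  obtain ⟨ψ, s, hs, rfl⟩ := hg
  exact ⟨ψ, s⁻¹, by rw [inv_inv]; exact hs.symm, by simp⟩

theorem map_mem_autOrbit (φ : MulAut G) {g : G} (hg : g ∈ autOrbit S) : φ g ∈ autOrbit S := by
  obtain ⟨ψ, s, hs, rfl⟩ := hg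
  exact ⟨φ * ψ, s, hs, by simp⟩

theorem submonoidClosure_autOrbit (hS : Subgroup.closure (autOrbit S) = ⊤) :
    Submonoid.closure (autOrbit S) = ⊤ :=
  submonoidClosure_eq_top_of_inv_mem (fun _ => inv_mem_autOrbit) hS

theorem IsAutNorm.exists_le_mul {M N : G → ℕ} (hM : IsAutNorm M) (hN : IsAutNorm N) :
    ∃ K : ℕ, ∀ x, M x ≤ K * N x := by
  obtain ⟨S, -, hS, rfl⟩ := hM
  obtain ⟨T, hT, hT', rfl⟩ := hN
  replace hS := submonoidClosure_autOrbit hS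
  obtain ⟨K, hK⟩ := ((hT.union hT.inv).image (wordNorm (autOrbit S))).bddAbove
  refine ⟨K, wordNorm_le_mul_wordNorm (submonoidClosure_autOrbit hT') hS ?_⟩
  rintro _ ⟨ψ, s, hs, rfl⟩
  exact (wordNorm_map_le hS (fun _ => map_mem_autOrbit ψ) s).trans (hK ⟨s, hs, rfl⟩)

theorem IsBoundedIn.of_le_mul {M N : G → ℕ} {x : G} (hx : IsBoundedIn N x) {K : ℕ}
    (hK : ∀ y, M y ≤ K * N y) : IsBoundedIn M x :=
  let ⟨C, hC⟩ := hx
  ⟨K * C, fun y hy => (hK y).trans (Nat.mul_le_mul_left K (hC y hy))⟩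

theorem IsUndistorted.of_le_mul {M N : G → ℕ} {x : G} (hx : IsUndistorted M x) {K : ℕ}
    (hK : ∀ y, M y ≤ K * N y) : IsUndistorted N x := by
  obtain ⟨C, hC, hCx⟩ := hx
  refine ⟨C / (K + 1), by positivity, fun n hn => ?_⟩
  rw [div_mul_eq_mul_div, div_lt_iff₀ (by positivity)]
  calc C * n < M (x ^ n) := hCx n hn
    _ ≤ K * N (x ^ n) := mod_cast hK _
    _ ≤ N (x ^ n) * (K + 1) := by linarith [(N (x ^ n)).cast_nonneg (α := ℝ)]

end WordNorm

section Primitive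

variable {F : Type u} [Group F] {ι : Type u}

theorem IsPrimitive.map {E : Type u} [Group E] {p : F} (hp : IsPrimitive p) (e : F ≃* E) :
    IsPrimitive (e p) := by
  obtain ⟨ι, B, i, rfl⟩ := hp
  exact ⟨ι, B.map e, i, by simp⟩

theorem isPrimitive_basis (B : FreeGroupBasis ι F) (i : ι) : IsPrimitive (B i) :=
  ⟨ι, B, i, rfl⟩

theorem IsPrimitive.conj {p : F} (hp : IsPrimitive p) (g : F) : IsPrimitive (g * p * g⁻¹) :=
  hp.map (MulAut.conj g)

/-- The automorphism of a free group that inverts every element of a basis. -/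
noncomputable def invBasis (B : FreeGroupBasis ι F) : MulAut F :=
  have h : (B.lift fun j => (B j)⁻¹).comp (B.lift fun j => (B j)⁻¹) = MonoidHom.id F :=
    B.ext_hom _ _ fun j => by simp
  MonoidHom.toMulEquiv _ _ h h

theorem IsPrimitive.inv {p : F} (hp : IsPrimitive p) : IsPrimitive p⁻¹ := by
  obtain ⟨ι, B, i, rfl⟩ := hp
  simpa [invBasis] using (isPrimitive_basis B i).map (invBasis B)

open Classical in
/-- The endomorphism of a free group that multiplies the basis element `B i` by `h` from the left
and fixes the other basis elements (a transvection if `h` does not involve `B i`). -/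
noncomputable def transvectionHom (B : FreeGroupBasis ι F) (i : ι) (h : F) : F →* F :=
  B.lift fun j => if j = i then h * B j else B j

theorem transvectionHom_of_mem (B : FreeGroupBasis ι F) {i : ι} (h : F) {k : F}
    (hk : k ∈ Subgroup.closure (B '' {i}ᶜ)) : transvectionHom B i h k = k := by
  refine MonoidHom.eqOn_closure (f := transvectionHom B i h) (g := MonoidHom.id F) ?_ hk
  rintro _ ⟨j, hj, rfl⟩
  simp_all [transvectionHom]

theorem transvectionHom_self (B : FreeGroupBasis ι F) (i : ι) (h : F) :
    transvectionHom B i h (B i) = h * B i := by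
  simp [transvectionHom]

theorem transvectionHom_comp (B : FreeGroupBasis ι F) {i : ι} {h k : F}
    (hk : k ∈ Subgroup.closure (B '' {i}ᶜ)) :
    (transvectionHom B i h).comp (transvectionHom B i k) = transvectionHom B i (k * h) := by
  refine B.ext_hom _ _ fun j => ?_
  rw [MonoidHom.comp_apply]
  by_cases hj : j = i
  · subst hj
    rw [transvectionHom_self, map_mul, transvectionHom_of_mem B h hk, transvectionHom_self,
      transvectionHom_self, mul_assoc]
  · have hB : B j ∈ Subgroup.closure (B '' {i}ᶜ) := Subgroup.subset_closure ⟨j, hj, rfl⟩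
    rw [transvectionHom_of_mem B k hB, transvectionHom_of_mem B h hB,
      transvectionHom_of_mem B _ hB]

theorem transvectionHom_one (B : FreeGroupBasis ι F) (i : ι) :
    transvectionHom B i 1 = MonoidHom.id F :=
  B.ext_hom _ _ fun j => by simp [transvectionHom]

theorem isPrimitive_mul (B : FreeGroupBasis ι F) (i : ι) {h : F}
    (hh : h ∈ Subgroup.closure (B '' {i}ᶜ)) : IsPrimitive (h * B i) := by
  let e : MulAut F := MonoidHom.toMulEquiv (transvectionHom B i h) (transvectionHom B i h⁻¹)
    (by rw [transvectionHom_comp B hh, mul_inv_cancel, transvectionHom_one])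
    (by rw [transvectionHom_comp B (inv_mem hh), inv_mul_cancel, transvectionHom_one])
  have he : e (B i) = h * B i := transvectionHom_self B i h
  exact he ▸ (isPrimitive_basis B i).map e

open Classical in
theorem IsPrimitive.exists_mulAut {p p' : F} (hp : IsPrimitive p) (hp' : IsPrimitive p') :
    ∃ ψ : MulAut F, ψ p = p' := by
  obtain ⟨ι, B, i, rfl⟩ := hp
  obtain ⟨ι', B', i', rfl⟩ := hp'
  let e : ι ≃ ι' := Equiv.ofFreeGroupEquiv (B.repr.symm.trans B'.repr)
  let C := B.reindex (e.trans (Equiv.swap (e i) i'))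
  have hC : C i' = B i := by simp [C]
  refine ⟨C.repr.trans B'.repr.symm, ?_⟩
  rw [← hC, MulEquiv.trans_apply, FreeGroupBasis.repr_apply_coe]
  rfl

theorem closure_range_basis (B : FreeGroupBasis ι F) : Subgroup.closure (Set.range B) = ⊤ := by
  have h : Set.range B = B.repr.symm.toMonoidHom '' Set.range FreeGroup.of :=
    Set.range_comp B.repr.symm FreeGroup.of
  rw [h, ← MonoidHom.map_closure, FreeGroup.closure_range_of,
    Subgroup.map_top_of_surjective _ B.repr.symm.surjective]

theorem nonempty_of_freeGroupBasis [Nontrivial F] (B : FreeGroupBasis ι F) : Nonempty ι := by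
  by_contra h
  rw [not_nonempty_iff] at h
  exact not_subsingleton F (B.repr.injective.subsingleton)

theorem closure_isPrimitive [IsFreeGroup F] : Subgroup.closure {p : F | IsPrimitive p} = ⊤ := by
  rw [eq_top_iff, ← closure_range_basis (IsFreeGroup.basis F)]
  exact Subgroup.closure_mono (Set.range_subset_iff.2 (isPrimitive_basis _))

theorem submonoidClosure_isPrimitive [IsFreeGroup F] :
    Submonoid.closure {p : F | IsPrimitive p} = ⊤ :=
  submonoidClosure_eq_top_of_inv_mem (fun _ => IsPrimitive.inv) closure_isPrimitive

theorem IsPrimitive.autOrbit_singleton {p : F} (hp : IsPrimitive p) :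
    autOrbit {p} = {y | IsPrimitive y} := by
  ext y
  constructor
  · rintro ⟨ψ, s, hs | hs, rfl⟩
    · exact (Set.mem_singleton_iff.1 hs ▸ hp).map ψ
    · exact (inv_inv s ▸ (Set.mem_singleton_iff.1 hs ▸ hp).inv).map ψ
  · intro hy
    obtain ⟨ψ, rfl⟩ := hp.exists_mulAut hy
    exact ⟨ψ, p, Or.inl rfl, rfl⟩

theorem isAutNorm_primitiveNorm [IsFreeGroup F] [Nontrivial F] :
    IsAutNorm (primitiveNorm : F → ℕ) := by
  let B := IsFreeGroup.basis F
  obtain ⟨i⟩ := nonempty_of_freeGroupBasis B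
  have hB := (isPrimitive_basis B i).autOrbit_singleton
  exact ⟨{B i}, Set.finite_singleton _, by rw [hB, closure_isPrimitive], by rw [hB]; rfl⟩

end Primitive

section FreeFactor

variable {F : Type u} [Group F] {ι κ : Type u}

/-- The homomorphism from a free group to the free product of the subgroups generated by the parts
`s` and `sᶜ` of a basis that sends each basis element to its copy in the corresponding factor. -/
noncomputable def toCoprod (B : FreeGroupBasis ι F) (s : Set ι) :
    F →* Monoid.Coprod (Subgroup.closure (B '' s)) (Subgroup.closure (B '' sᶜ)) :=
  open Classical in
  B.lift fun j => if hj : j ∈ s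
    then Monoid.Coprod.inl ⟨B j, Subgroup.subset_closure ⟨j, hj, rfl⟩⟩
    else Monoid.Coprod.inr ⟨B j, Subgroup.subset_closure ⟨j, hj, rfl⟩⟩

theorem toCoprod_comp_lift (B : FreeGroupBasis ι F) (s : Set ι) :
    (toCoprod B s).comp (Monoid.Coprod.lift (Subgroup.closure (B '' s)).subtype
      (Subgroup.closure (B '' sᶜ)).subtype) = MonoidHom.id _ := by
  refine Monoid.Coprod.hom_ext ?_ ?_ <;>
  · refine MonoidHom.eq_of_eqOn_dense Subgroup.closure_closure_coe_preimage ?_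
    rintro ⟨_, _⟩ ⟨j, hj, rfl⟩
    simp_all [toCoprod]

theorem lift_comp_toCoprod (B : FreeGroupBasis ι F) (s : Set ι) :
    (Monoid.Coprod.lift (Subgroup.closure (B '' s)).subtype
      (Subgroup.closure (B '' sᶜ)).subtype).comp (toCoprod B s) = MonoidHom.id F := by
  refine B.ext_hom _ _ fun j => ?_
  by_cases hj : j ∈ s <;> simp [toCoprod, hj]

theorem isFreeFactor_closure_image (B : FreeGroupBasis ι F) (s : Set ι) :
    IsFreeFactor (Subgroup.closure (B '' s)) :=
  ⟨_, (MonoidHom.toMulEquiv _ _ (toCoprod_comp_lift B s) (lift_comp_toCoprod B s)).bijective⟩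

theorem notMem_closure_image (B : FreeGroupBasis ι F) {s : Set ι} {i : ι} (hi : i ∉ s) :
    B i ∉ Subgroup.closure (B '' s) := by
  classical
  intro h
  let f : F →* Multiplicative ℤ := B.lift (Pi.mulSingle i (Multiplicative.ofAdd 1))
  have hf : Subgroup.closure (B '' s) ≤ f.ker := by
    rw [Subgroup.closure_le]
    rintro _ ⟨j, hj, rfl⟩
    have hji : j ≠ i := ne_of_mem_of_not_mem hj hi
    simp [f, MonoidHom.mem_ker, hji]
  simpa [f, MonoidHom.mem_ker] using hf h

theorem isSeparable_of_mem_closure_image (B : FreeGroupBasis ι F) {s : Set ι} (hs : s ≠ Set.univ)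
    {x : F} (hx : x ∈ Subgroup.closure (B '' s)) : IsSeparable x := by
  obtain ⟨i, hi⟩ := (Set.ne_univ_iff_exists_notMem s).1 hs
  exact ⟨_, isFreeFactor_closure_image B s,
    fun h => notMem_closure_image B hi (h ▸ Subgroup.mem_top _), 1, by simpa using hx⟩

/-- The basis of a free product of two free groups that is obtained from bases of the factors. -/
noncomputable def coprodBasis {H K : Type u} [Group H] [Group K] (BH : FreeGroupBasis ι H)
    (BK : FreeGroupBasis κ K) : FreeGroupBasis (ι ⊕ κ) (Monoid.Coprod H K) :=
  .ofRepr <| MonoidHom.toMulEquiv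
    (Monoid.Coprod.lift (BH.lift fun a => FreeGroup.of (Sum.inl a))
      (BK.lift fun b => FreeGroup.of (Sum.inr b)))
    (FreeGroup.lift (Sum.elim (Monoid.Coprod.inl ∘ BH) (Monoid.Coprod.inr ∘ BK)))
    (Monoid.Coprod.hom_ext (BH.ext_hom _ _ fun a => by simp) (BK.ext_hom _ _ fun b => by simp))
    (FreeGroup.ext_hom _ _ (by rintro (a | b) <;> simp))

theorem coprodBasis_inl {H K : Type u} [Group H] [Group K] (BH : FreeGroupBasis ι H)
    (BK : FreeGroupBasis κ K) (a : ι) :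
    coprodBasis BH BK (Sum.inl a) = Monoid.Coprod.inl (BH a) := by
  rw [← (coprodBasis BH BK).repr.injective.eq_iff, FreeGroupBasis.repr_apply_coe]
  simp [coprodBasis]

theorem IsFreeFactor.exists_basis [IsFreeGroup F] {H : Subgroup F} (hH : IsFreeFactor H) :
    ∃ (ι κ : Type u) (B : FreeGroupBasis (ι ⊕ κ) F),
      Subgroup.closure (B '' Set.range Sum.inl) = H := by
  obtain ⟨K, hHK⟩ := hH
  let BH := IsFreeGroup.basis H
  let B := (coprodBasis BH (IsFreeGroup.basis K)).map (MulEquiv.ofBijective _ hHK)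
  have hB : B '' Set.range Sum.inl = H.subtype '' Set.range BH := by
    rw [← Set.range_comp, ← Set.range_comp]
    exact congrArg Set.range (funext fun a => by simp [B, coprodBasis_inl])
  refine ⟨_, _, B, ?_⟩
  rw [hB, ← MonoidHom.map_closure, closure_range_basis, ← MonoidHom.range_eq_map,
    Subgroup.range_subtype]

theorem IsSeparable.exists_basis [IsFreeGroup F] {x : F} (hx : IsSeparable x) :
    ∃ (ι : Type u) (B : FreeGroupBasis ι F) (i : ι) (g : F),
      g * x * g⁻¹ ∈ Subgroup.closure (B '' {i}ᶜ) := by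
  obtain ⟨H, hH, hne, g, hg⟩ := hx
  obtain ⟨ι, κ, B, rfl⟩ := hH.exists_basis
  obtain ⟨j⟩ : Nonempty κ := by
    by_contra h
    rw [not_nonempty_iff] at h
    have hrange : Set.range (Sum.inl : ι → ι ⊕ κ) = Set.univ :=
      Set.range_eq_univ.2 (Equiv.sumEmpty ι κ).symm.surjective
    exact hne (by rw [hrange, Set.image_univ, closure_range_basis])
  refine ⟨_, B, Sum.inr j, g, Subgroup.closure_mono (Set.image_mono ?_) hg⟩
  rintro _ ⟨a, rfl⟩
  exact Sum.inl_ne_inr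

theorem IsSeparable.primitiveNorm_zpow_le [IsFreeGroup F] {x : F} (hx : IsSeparable x) (n : ℤ) :
    primitiveNorm (x ^ n) ≤ 2 := by
  obtain ⟨ι, B, i, g, h⟩ := hx.exists_basis
  have hx' : x ^ n = g⁻¹ * ((g * x * g⁻¹) ^ n * B i) * g⁻¹⁻¹ * (g⁻¹ * (B i)⁻¹ * g⁻¹⁻¹) := by
    rw [conj_zpow]
    group
  have hp := (isPrimitive_mul B i (zpow_mem h n)).conj g⁻¹
  have hp' := (isPrimitive_basis B i).inv.conj g⁻¹
  rw [hx', ← List.prod_pair]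
  exact wordNorm_list_prod_le (List.forall_mem_cons.2 ⟨hp, List.forall_mem_singleton.2 hp'⟩)

theorem IsSeparable.isBoundedIn_primitiveNorm [IsFreeGroup F] {x : F} (hx : IsSeparable x) :
    IsBoundedIn primitiveNorm x :=
  ⟨2, fun _ ⟨n, hn⟩ => hn ▸ hx.primitiveNorm_zpow_le n⟩

end FreeFactor

section Quasimorphism

variable {G : Type u} [Group G] {q r : G → ℝ} {D : ℝ}

theorem abs_map_pow_sub_le (hq : ∀ a b, |q a - q (a * b) + q b| ≤ D) (a : G) (n : ℕ) :
    |q (a ^ (n + 1)) - (n + 1) * q a| ≤ n * D := by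
  induction n with
  | zero => simp
  | succ n ih =>
    have h := hq (a ^ (n + 1)) a
    rw [← pow_succ] at h
    rw [abs_le] at *
    push_cast
    constructor <;> linarith

theorem abs_map_pow_div_sub_le (hq : ∀ a b, |q a - q (a * b) + q b| ≤ D) (a : G) {n : ℕ}
    (hn : 0 < n) : |q (a ^ n) / n - q a| ≤ D := by
  obtain ⟨m, rfl⟩ := Nat.exists_eq_succ_of_ne_zero hn.ne'
  have hD : 0 ≤ D := (abs_nonneg _).trans (hq 1 1)
  have hm : (0 : ℝ) < m.succ := by positivity
  rw [div_sub' hm.ne', abs_div, abs_of_pos hm, div_le_iff₀ hm]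
  have h := abs_map_pow_sub_le hq a m
  push_cast
  linarith

theorem IsQuasimorphism.exists_isHomogenization (hq : IsQuasimorphism q) :
    ∃ r : G → ℝ, IsHomogenization q r := by
  obtain ⟨D, hD⟩ := hq
  replace hD := fun a b => (hD a b).le
  refine Classical.axiomOfChoice (r := fun a L => Filter.Tendsto (fun n : ℕ => q (a ^ n) / (n : ℝ))
    Filter.atTop (nhds L)) fun a => ?_
  have hsub : Subadditive fun n : ℕ => q (a ^ n) + D := fun m n => by
    have h := (abs_le.1 (hD (a ^ m) (a ^ n))).1
    rw [← pow_add] at h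
    linarith
  have hbdd : BddBelow (Set.range fun n : ℕ => (q (a ^ n) + D) / (n : ℝ)) := by
    refine ⟨min 0 (q a - D), Set.forall_mem_range.2 fun n => ?_⟩
    rcases Nat.eq_zero_or_pos n with rfl | hn
    · simp
    · have h := (abs_le.1 (abs_map_pow_div_sub_le hD a hn)).1
      have h' : 0 ≤ D / (n : ℝ) := div_nonneg ((abs_nonneg _).trans (hD 1 1)) n.cast_nonneg
      rw [add_div]
      exact (min_le_right _ _).trans (by linarith)
  refine ⟨_, ((hsub.tendsto_lim hbdd).sub (tendsto_const_div_atTop_nhds_zero_nat D)).congr ?_⟩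
  exact fun n => by ring

theorem IsHomogenization.abs_sub_le (h : IsHomogenization q r)
    (hq : ∀ a b, |q a - q (a * b) + q b| ≤ D) (a : G) : |r a - q a| ≤ D := by
  refine le_of_tendsto ((h a).sub_const (q a)).abs ?_
  filter_upwards [Filter.eventually_gt_atTop 0] with n hn using abs_map_pow_div_sub_le hq a hn

theorem IsHomogenization.map_pow (h : IsHomogenization q r) (a : G) (k : ℕ) :
    r (a ^ k) = k * r a := by
  refine tendsto_nhds_unique (h (a ^ k)) ?_
  rcases Nat.eq_zero_or_pos k with rfl | hk
  · simpa using tendsto_const_div_atTop_nhds_zero_nat (q 1)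
  · have hkn : Filter.Tendsto (fun n : ℕ => k * n) Filter.atTop Filter.atTop :=
      Filter.tendsto_id.const_mul_atTop' hk
    refine (((h a).comp hkn).const_mul (k : ℝ)).congr fun n => ?_
    simp only [Function.comp_apply, Nat.cast_mul, pow_mul]
    field_simp

theorem IsHomogenization.map_inv (h : IsHomogenization q r)
    (hq : ∀ a b, |q a - q (a * b) + q b| ≤ D) (a : G) : r a⁻¹ = -r a := by
  rw [eq_neg_iff_add_eq_zero]
  refine tendsto_nhds_unique ((h a⁻¹).add (h a)) ?_
  refine squeeze_zero_norm (fun n => ?_) (tendsto_const_div_atTop_nhds_zero_nat (D + |q 1|))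
  have hn := abs_add_le (q (a⁻¹ ^ n) - q (a⁻¹ ^ n * a ^ n) + q (a ^ n)) (q 1)
  rw [inv_pow, inv_mul_cancel, sub_add_eq_add_sub, sub_add_cancel] at hn
  rw [← add_div, norm_div, RCLike.norm_natCast, Real.norm_eq_abs, inv_pow]
  gcongr
  refine hn.trans (add_le_add_left ?_ _)
  simpa [sub_add_eq_add_sub] using hq (a ^ n)⁻¹ (a ^ n)

theorem IsHomogenization.isHomogeneousQuasimorphism (h : IsHomogenization q r)
    (hq : IsQuasimorphism q) : IsHomogeneousQuasimorphism r := by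
  obtain ⟨D, hD⟩ := hq
  replace hD := fun a b => (hD a b).le
  refine ⟨⟨4 * D + 1, fun a b => ?_⟩, fun a n => ?_⟩
  · have ha := abs_le.1 (h.abs_sub_le hD a)
    have hb := abs_le.1 (h.abs_sub_le hD b)
    have hab := abs_le.1 (h.abs_sub_le hD (a * b))
    have hq := abs_le.1 (hD a b)
    rw [abs_lt]
    constructor <;> linarith
  · obtain ⟨k, rfl | rfl⟩ := n.eq_nat_or_neg
    · simpa using h.map_pow a k
    · rw [zpow_neg, h.map_inv hD, zpow_natCast, h.map_pow, Int.cast_neg, Int.cast_natCast,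
        neg_mul]

theorem IsHomogeneousQuasimorphism.map_pow (h : IsHomogeneousQuasimorphism r) (a : G) (n : ℕ) :
    r (a ^ n) = n * r a :=
  mod_cast h.2 a n

theorem IsHomogeneousQuasimorphism.map_inv (h : IsHomogeneousQuasimorphism r) (a : G) :
    r a⁻¹ = -r a := by
  simpa using h.2 a (-1)

theorem eq_of_forall_mul_abs_sub_le {s t C : ℝ} (h : ∀ n : ℕ, n * |s - t| ≤ C) : s = t := by
  by_contra hne
  obtain ⟨n, hn⟩ := exists_lt_nsmul (abs_pos.2 (sub_ne_zero.2 hne)) C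
  exact (h n).not_gt (nsmul_eq_mul n |s - t| ▸ hn)

theorem IsHomogeneousQuasimorphism.map_conj (h : IsHomogeneousQuasimorphism r) (g a : G) :
    r (g * a * g⁻¹) = r a := by
  obtain ⟨D, hD⟩ := h.1
  have hconj : ∀ b, |r (g * b * g⁻¹) - r b| ≤ 2 * D := fun b => by
    have h₁ := abs_lt.1 (hD (g * b) g⁻¹)
    have h₂ := abs_lt.1 (hD g b)
    rw [h.map_inv] at h₁
    rw [abs_le]
    constructor <;> linarith
  refine eq_of_forall_mul_abs_sub_le (C := 2 * D) fun n => ?_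
  calc n * |r (g * a * g⁻¹) - r a| = |r ((g * a * g⁻¹) ^ n) - r (a ^ n)| := by
        rw [h.map_pow, h.map_pow, ← mul_sub, abs_mul, Nat.abs_cast]
    _ = |r (g * a ^ n * g⁻¹) - r (a ^ n)| := by rw [conj_pow]
    _ ≤ 2 * D := hconj _

theorem abs_map_list_prod_le (hr : ∀ a b, |r a - r (a * b) + r b| ≤ D) (hr1 : r 1 = 0) {C : ℝ}
    {l : List G} (hl : ∀ s ∈ l, |r s| ≤ C) : |r l.prod| ≤ (C + D) * l.length := by
  induction l with
  | nil => simp [hr1]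
  | cons a l ih =>
    obtain ⟨ha, hl⟩ := List.forall_mem_cons.1 hl
    have hprod := abs_le.1 (ih hl)
    have h := abs_le.1 (hr a l.prod)
    rw [abs_le] at ha
    rw [List.prod_cons, List.length_cons, abs_le]
    push_cast
    constructor <;> linarith

theorem IsHomogeneousQuasimorphism.isUndistorted (h : IsHomogeneousQuasimorphism r) {S : Set G}
    (hS : Submonoid.closure S = ⊤) {C : ℝ} (hC : ∀ s ∈ S, |r s| ≤ C) {x : G} (hx : r x ≠ 0) :
    IsUndistorted (wordNorm S) x := by
  obtain ⟨D, hD⟩ := h.1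
  have hr1 : r 1 = 0 := by simpa using h.2 1 0
  have hle : ∀ y, |r y| ≤ (|C| + D) * wordNorm S y := fun y => by
    obtain ⟨l, hl, rfl, hlen⟩ := exists_list_length_eq_wordNorm hS y
    rw [← hlen]
    exact abs_map_list_prod_le (fun a b => (hD a b).le) hr1
      fun s hs => (hC s (hl s hs)).trans (le_abs_self C)
  have hK : 0 < |C| + D :=
    add_pos_of_nonneg_of_pos (abs_nonneg C) ((abs_nonneg _).trans_lt (hD 1 1))
  have hx' : 0 < |r x| := abs_pos.2 hx
  refine ⟨|r x| / (2 * (|C| + D)), div_pos hx' (mul_pos two_pos hK), fun n hn => ?_⟩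
  rw [div_mul_eq_mul_div, div_lt_iff₀ (mul_pos two_pos hK)]
  calc |r x| * n < 2 * (|r x| * n) := lt_two_mul_self (mul_pos hx' (Nat.cast_pos.2 hn))
    _ = 2 * |r (x ^ n)| := by rw [h.map_pow, abs_mul, Nat.abs_cast, mul_comm |r x|]
    _ ≤ 2 * ((|C| + D) * wordNorm S (x ^ n)) := by gcongr; exact hle _
    _ = wordNorm S (x ^ n) * (2 * (|C| + D)) := by ring

end Quasimorphism

section Occurrences

variable {α : Type u}

theorem occurrences_eq_zero_iff {w l : List α} : occurrences w l = 0 ↔ ¬ w <:+: l := by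
  classical
  simp only [occurrences, List.countP_eq_zero, List.mem_tails, decide_eq_true_eq,
    List.infix_iff_prefix_suffix, not_exists, not_and, imp_not_comm]

theorem occurrences_nil {w : List α} (hw : w ≠ []) : occurrences w [] = 0 := by
  rw [occurrences_eq_zero_iff, List.infix_nil]
  exact hw

open Classical in
theorem occurrences_cons (w : List α) (a : α) (l : List α) :
    occurrences w (a :: l) = occurrences w l + if w <+: a :: l then 1 else 0 := by
  simp [occurrences, List.countP_cons]

theorem add_occurrences_le_append {w : List α} (hw : w ≠ []) (u v : List α) :
    occurrences w u + occurrences w v ≤ occurrences w (u ++ v) := by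
  classical
  induction u with
  | nil => simp [occurrences_nil hw]
  | cons a u ih =>
    have h : w <+: a :: u → w <+: a :: (u ++ v) := fun h => h.trans (List.prefix_append (a :: u) v)
    rw [List.cons_append, occurrences_cons, occurrences_cons]
    split_ifs <;> first | omega | tauto

theorem occurrences_append_le (w u v : List α) :
    occurrences w (u ++ v) ≤ occurrences w u + occurrences w v + w.length := by
  classical
  suffices h : occurrences w (u ++ v) ≤
      occurrences w u + occurrences w v + min u.length w.length from h.trans (by omega)
  induction u with
  | nil => simp
  | cons a u ih =>
    have h : w <+: a :: (u ++ v) → w.length ≤ u.length + 1 → w <+: a :: u := fun h hl =>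
      List.prefix_of_prefix_length_le h (List.prefix_append (a :: u) v) hl
    rw [List.cons_append, occurrences_cons, occurrences_cons, List.length_cons]
    split_ifs <;> first | omega | (by_cases hl : w.length ≤ u.length + 1; tauto; omega)

theorem le_occurrences_flatten_replicate {X : List α} (hX : X ≠ []) (n : ℕ) :
    n ≤ occurrences (X ++ X) (List.replicate (n + 1) X).flatten := by
  classical
  obtain ⟨a, X', rfl⟩ := List.exists_cons_of_ne_nil hX
  induction n with
  | zero => simp
  | succ n ih =>
    have hprefix : (a :: X') ++ (a :: X') <+:
        a :: (X' ++ (List.replicate (n + 1) (a :: X')).flatten) :=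
      ⟨(List.replicate n (a :: X')).flatten, by simp [List.replicate_succ]⟩
    have hadd := add_occurrences_le_append (w := (a :: X') ++ (a :: X')) (by simp) X'
      (List.replicate (n + 1) (a :: X')).flatten
    rw [List.replicate_succ, List.flatten_cons, List.cons_append (bs := List.flatten _),
      occurrences_cons, if_pos hprefix]
    omega

theorem cons_flatten_replicate_concat (a : α) (Y : List α) (n : ℕ) :
    a :: (List.replicate n (Y ++ [a])).flatten = (List.replicate n (a :: Y)).flatten ++ [a] := by
  induction n with
  | zero => simp
  | succ n ih => simp [List.replicate_succ, ih]

theorem eq_rotate_of_append_prefix_flatten {S X Y : List α} (hXY : X.length = Y.length) {n : ℕ}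
    (h : S ++ X <+: (List.replicate n Y).flatten) : X = Y.rotate S.length := by
  induction S generalizing Y with
  | nil =>
    rw [List.length_nil, List.rotate_zero]
    cases n with
    | zero => simp_all [eq_comm]
    | succ n =>
      exact (List.prefix_of_prefix_length_le h
        (by simp [List.replicate_succ]) hXY.le).eq_of_length hXY
  | cons a S ih =>
    cases Y with
    | nil => simp_all
    | cons b Y =>
      have h' := h.trans (List.prefix_append _ [b])
      rw [← cons_flatten_replicate_concat, List.cons_append, List.cons_prefix_cons] at h'
      rw [ih (by simpa using hXY) h'.2, List.length_cons, List.rotate_cons_succ]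

theorem isRotated_of_infix_flatten {X Y : List α} (hXY : X.length = Y.length) {n : ℕ}
    (h : X <:+: (List.replicate n Y).flatten) : Y ~r X := by
  obtain ⟨S, T, h⟩ := h
  exact ⟨S.length, (eq_rotate_of_append_prefix_flatten hXY ⟨T, h⟩).symm⟩

end Occurrences

section Brooks

open FreeGroup

variable {ι : Type u}

theorem isReduced_append_of_ne {u v : List (ι × Bool)} {a b : ι × Bool}
    (hu : IsReduced (u ++ [a])) (hv : IsReduced (b :: v)) (hab : a.1 = b.1 → a.2 = b.2) :
    IsReduced (u ++ [a] ++ b :: v) :=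
  List.isChain_append.2 ⟨hu, hv, by simpa using hab⟩

theorem exists_cancellation {L₁ L₂ : List (ι × Bool)} (h₁ : IsReduced L₁) (h₂ : IsReduced L₂) :
    ∃ u t v, L₁ = u ++ t ∧ L₂ = invRev t ++ v ∧ IsReduced (u ++ v) := by
  induction L₂ generalizing L₁ with
  | nil => exact ⟨L₁, [], [], by simp, by simp, by simpa⟩
  | cons b L₂ ih =>
    rcases List.eq_nil_or_concat L₁ with rfl | ⟨L, a, rfl⟩
    · exact ⟨[], [], b :: L₂, rfl, by simp, by simpa⟩
    · rw [List.concat_eq_append] at *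
      by_cases hab : a.1 = b.1 → a.2 = b.2
      · exact ⟨L ++ [a], [], b :: L₂, by simp, by simp, isReduced_append_of_ne h₁ h₂ hab⟩
      · obtain ⟨u, t, v, rfl, rfl, h⟩ := ih (L₁ := L) (h₁.infix ⟨[], [a], by simp⟩)
          (h₂.infix ⟨[b], [], by simp⟩)
        have hba : b = (a.1, !a.2) := by
          rw [Classical.not_imp] at hab
          exact Prod.ext hab.1.symm (Bool.eq_not.2 (Ne.symm hab.2))
        exact ⟨u, t ++ [a], v, by simp, by simp [invRev, hba], h⟩

theorem exists_toWord_mul [DecidableEq ι] (g h : FreeGroup ι) :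
    ∃ u t v, g.toWord = u ++ t ∧ h.toWord = invRev t ++ v ∧ (g * h).toWord = u ++ v := by
  obtain ⟨u, t, v, hg, hh, huv⟩ := exists_cancellation (isReduced_toWord (x := g))
    (isReduced_toWord (x := h))
  refine ⟨u, t, v, hg, hh, ?_⟩
  have hmul : g * h = mk (u ++ v) := by
    rw [← mk_toWord (x := g), ← mk_toWord (x := h), hg, hh, ← mul_mk, ← mul_mk, ← mul_mk, ← inv_mk]
    group
  rw [hmul, toWord_mk, huv.reduce_eq]

/-- The number of occurrences of `w` in the word `l` minus that in the inverse word of `l`. -/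
noncomputable def signedCount (w l : List (ι × Bool)) : ℝ :=
  (occurrences w l : ℝ) - (occurrences w (invRev l) : ℝ)

theorem signedCount_invRev (w l : List (ι × Bool)) :
    signedCount w (invRev l) = -signedCount w l := by
  simp [signedCount]

theorem abs_signedCount_append_sub_le {w : List (ι × Bool)} (hw : w ≠ [])
    (u v : List (ι × Bool)) :
    |signedCount w (u ++ v) - signedCount w u - signedCount w v| ≤ w.length := by
  have hle := add_occurrences_le_append hw u v
  have hge := occurrences_append_le w u v
  have hle' := add_occurrences_le_append hw (invRev v) (invRev u)
  have hge' := occurrences_append_le w (invRev v) (invRev u)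
  rw [signedCount, signedCount, signedCount, invRev_append, abs_le]
  rify at *
  constructor <;> linarith

variable {F : Type u} [Group F] (B : FreeGroupBasis ι F)

theorem reducedWord_inv (x : F) : reducedWord B x⁻¹ = invRev (reducedWord B x) := by
  classical
  rw [reducedWord, _root_.map_inv, toWord_inv, reducedWord]

theorem reducedWord_ne_nil {x : F} (hx : x ≠ 1) : reducedWord B x ≠ [] := by
  simpa [reducedWord, toWord_eq_nil_iff] using hx

theorem reducedWord_pow {x : F} (hx : IsCyclicallyReduced (reducedWord B x)) (n : ℕ) :
    reducedWord B (x ^ n) = (List.replicate n (reducedWord B x)).flatten := by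
  classical
  rw [reducedWord, map_pow, toWord_pow]
  exact (hx.flatten_replicate n).isReduced.reduce_eq

theorem brooks_eq_signedCount (w x : F) :
    brooks B w x = signedCount (reducedWord B w) (reducedWord B x) := by
  rw [brooks, signedCount, reducedWord_inv]

theorem abs_brooks_le {w : F} (hw : w ≠ 1) (a b : F) :
    |brooks B w a - brooks B w (a * b) + brooks B w b| ≤ 3 * (reducedWord B w).length := by
  classical
  obtain ⟨u, t, v, ha, hb, hab⟩ := exists_toWord_mul (B.repr a) (B.repr b)
  rw [← _root_.map_mul] at hab
  have hw' := reducedWord_ne_nil B hw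
  have hut := abs_le.1 (abs_signedCount_append_sub_le hw' u t)
  have htv := abs_le.1 (abs_signedCount_append_sub_le hw' (invRev t) v)
  have huv := abs_le.1 (abs_signedCount_append_sub_le hw' u v)
  rw [signedCount_invRev] at htv
  rw [brooks_eq_signedCount, brooks_eq_signedCount, brooks_eq_signedCount,
    show reducedWord B a = _ from ha, show reducedWord B b = _ from hb,
    show reducedWord B (a * b) = _ from hab, abs_le]
  constructor <;> linarith

theorem isQuasimorphism_brooks {w : F} (hw : w ≠ 1) : IsQuasimorphism (brooks B w) :=
  ⟨_, fun a b => (abs_brooks_le B hw a b).trans_lt (lt_add_one _)⟩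

theorem eq_nil_of_invRev_eq {s : List (ι × Bool)} (hs : IsReduced s) (h : invRev s = s) :
    s = [] := by
  classical
  have hsq : mk s ^ 2 = 1 := by
    rw [pow_two, ← eq_inv_iff_mul_eq_one, inv_mk, h]
  have h1 : mk s = 1 := (pow_eq_one_iff_left two_ne_zero).1 hsq
  rw [← hs.reduce_eq, ← toWord_mk, h1, toWord_one]

theorem not_infix_flatten_invRev {X : List (ι × Bool)} (hX : IsReduced X) (hne : X ≠ []) (n : ℕ) :
    ¬ X <:+: (List.replicate n (invRev X)).flatten := by
  intro h
  obtain ⟨k, hk, hrot⟩ := List.isRotated_iff_mod.1 (isRotated_of_infix_flatten (by simp) h).symm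
  rw [List.rotate_eq_drop_append_take hk] at hrot
  nth_rw 3 [← List.take_append_drop k X] at hrot
  rw [invRev_append] at hrot
  obtain ⟨hdrop, htake⟩ := List.append_inj hrot (by simp)
  have hdrop' := eq_nil_of_invRev_eq (hX.infix (List.drop_suffix k X).isInfix) hdrop.symm
  have htake' := eq_nil_of_invRev_eq (hX.infix (List.take_prefix k X).isInfix) htake.symm
  exact hne (by rw [← List.take_append_drop k X, hdrop', htake', List.append_nil])

theorem invRev_flatten_replicate (X : List (ι × Bool)) (n : ℕ) :
    invRev (List.replicate n X).flatten = (List.replicate n (invRev X)).flatten := by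
  induction n with
  | zero => simp
  | succ n ih =>
    rw [List.replicate_succ', List.flatten_concat, invRev_append, ih, List.replicate_succ,
      List.flatten_cons]

theorem sub_one_le_brooks_sq_pow {x : F} (hx : IsCyclicallyReduced (reducedWord B x)) (hne : x ≠ 1)
    (n : ℕ) : (n : ℝ) - 1 ≤ brooks B (x ^ 2) (x ^ n) := by
  have hX := reducedWord_ne_nil B hne
  have hsq : reducedWord B (x ^ 2) = reducedWord B x ++ reducedWord B x := by
    simp [reducedWord_pow B hx, List.replicate_succ]
  have hinv : occurrences (reducedWord B (x ^ 2)) (reducedWord B (x ^ n)⁻¹) = 0 := by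
    rw [occurrences_eq_zero_iff, reducedWord_inv, reducedWord_pow B hx n,
      invRev_flatten_replicate, hsq]
    exact fun h => not_infix_flatten_invRev hx.isReduced hX n
      ((List.prefix_append _ (reducedWord B x)).isInfix.trans h)
  rw [brooks, hinv, Nat.cast_zero, sub_zero]
  cases n with
  | zero => exact (by simp : ((0 : ℕ) : ℝ) - 1 ≤ 0).trans (Nat.cast_nonneg _)
  | succ n =>
    rw [reducedWord_pow B hx (n + 1), hsq, Nat.cast_add_one, add_sub_cancel_right]
    exact mod_cast le_occurrences_flatten_replicate hX n

theorem one_le_homogenization_brooks_sq {x : F} (hx : IsCyclicallyReduced (reducedWord B x))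
    (hne : x ≠ 1) {q : F → ℝ} (hq : IsHomogenization (brooks B (x ^ 2)) q) : 1 ≤ q x := by
  have hlim := (tendsto_const_div_atTop_nhds_zero_nat (1 : ℝ)).const_sub 1
  rw [sub_zero] at hlim
  refine le_of_tendsto_of_tendsto hlim (hq x) ?_
  filter_upwards [Filter.eventually_gt_atTop 0] with n hn
  have hn' : (0 : ℝ) < n := Nat.cast_pos.2 hn
  rw [one_sub_div hn'.ne']
  exact div_le_div_of_nonneg_right (sub_one_le_brooks_sq_pow B hx hne n) hn'.le

end Brooks

/-- A subset of a group is almost invariant if each of its right translates differs from it by a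
finite set. The existence of such sets expresses that the group has several ends. -/
def AlmostInvariant {G : Type u} [Group G] (A : Set G) : Prop :=
  ∀ s : G, ∀ᶠ g in Filter.cofinite, (g * s ∈ A ↔ g ∈ A)

section AlmostInvariant

variable {G : Type u} [Group G]

theorem AlmostInvariant.of_closure_eq_top {A S : Set G} (hS : Subgroup.closure S = ⊤)
    (h : ∀ s ∈ S, ∀ᶠ g in Filter.cofinite, (g * s ∈ A ↔ g ∈ A)) : AlmostInvariant A := by
  intro s
  have hs : s ∈ Subgroup.closure S := hS ▸ Subgroup.mem_top s
  induction hs using Subgroup.closure_induction with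
  | mem s hs => exact h s hs
  | one => simp
  | mul s t _ _ hs ht =>
    filter_upwards [hs, (mul_left_injective s).tendsto_cofinite.eventually ht] with g hgs hgt
    rw [← mul_assoc, hgt, hgs]
  | inv s _ hs =>
    filter_upwards [(mul_left_injective s⁻¹).tendsto_cofinite.eventually hs] with g hg
    rwa [inv_mul_cancel_right, iff_comm] at hg

theorem AlmostInvariant.preimage {H : Type u} [Group H] {A : Set H} (hA : AlmostInvariant A)
    (e : G ≃* H) : AlmostInvariant (e ⁻¹' A) := by
  intro s
  filter_upwards [e.injective.tendsto_cofinite.eventually (hA (e s))] with g hg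
  rwa [Set.mem_preimage, map_mul]

theorem mul_zpow_mem_iff {A : Set G} {c : G} (hc : ∀ g, g * c ∈ A ↔ g ∈ A) (g : G) (k : ℤ) :
    g * c ^ k ∈ A ↔ g ∈ A := by
  induction k with
  | zero => simp
  | succ k ih => rw [zpow_add_one, ← mul_assoc, hc, ih]
  | pred k ih => rw [← ih, ← hc (g * c ^ (-(k : ℤ) - 1)), mul_assoc, ← zpow_add_one, sub_add_cancel]

end AlmostInvariant

section Letters

open FreeGroup

variable {ι : Type u}

/-- The inverse of a letter: `(i, true)` stands for the generator `i` and `(i, false)` for its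
inverse. -/
def letterInv (a : ι × Bool) : ι × Bool := (a.1, !a.2)

theorem letterInv_letterInv (a : ι × Bool) : letterInv (letterInv a) = a := by
  simp [letterInv]

theorem letterInv_ne (a : ι × Bool) : letterInv a ≠ a := by
  simp [letterInv, Prod.ext_iff]

theorem invRev_append_singleton (L : List (ι × Bool)) (a : ι × Bool) :
    invRev (L ++ [a]) = letterInv a :: invRev L := by
  simp [invRev, letterInv]

theorem compatible_iff_ne_letterInv {a b : ι × Bool} :
    (a.1 = b.1 → a.2 = b.2) ↔ b ≠ letterInv a := by
  rw [Ne, Prod.ext_iff, letterInv, Bool.eq_not, not_and, not_not, eq_comm, @eq_comm _ a.2]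

theorem isReduced_append_cons_iff {W T : List (ι × Bool)} {z : ι × Bool} :
    IsReduced (W ++ z :: T) ↔
      IsReduced W ∧ IsReduced (z :: T) ∧ W.getLast?.map letterInv ≠ some z := by
  unfold FreeGroup.IsReduced
  rw [List.isChain_append]
  refine and_congr_right fun _ => and_congr_right fun _ => ?_
  cases W.getLast? <;> simp [compatible_iff_ne_letterInv, eq_comm]

theorem isCyclicallyReduced_invRev {X : List (ι × Bool)} (hX : IsCyclicallyReduced X) :
    IsCyclicallyReduced (invRev X) := by
  classical
  rw [isCyclicallyReduced_iff] at *
  refine ⟨?_, ?_⟩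
  · rw [isReduced_iff_reduce_eq, reduce_invRev, hX.1.reduce_eq]
  · simp only [invRev, List.getLast?_reverse, List.head?_map, List.head?_reverse,
      List.getLast?_map, Option.mem_def, Option.map_eq_some_iff]
    rintro _ ⟨a, ha, rfl⟩ _ ⟨b, hb, rfl⟩ hab
    rw [hX.2 b hb a ha hab.symm]

end Letters

section FirstLetter

open FreeGroup

variable {ι : Type u} [DecidableEq ι]

theorem head?_toWord_mul_of {i j : ι} {g : FreeGroup ι} (h : i ≠ j ∨ g ≠ 1) :
    (g * of i).toWord.head? = some (j, true) ↔ g.toWord.head? = some (j, true) := by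
  obtain ⟨u, t, v, hg, hi, hgi⟩ := exists_toWord_mul g (of i)
  rw [hg, hgi]
  cases u with
  | cons a u => simp
  | nil =>
    rw [toWord_of] at hi
    rcases List.eq_nil_or_concat t with rfl | ⟨t, a, rfl⟩
    · have hij : i ≠ j := h.resolve_right (not_not.2 (toWord_eq_nil_iff.1 hg))
      rw [invRev_empty, List.nil_append] at hi
      simp [← hi, hij]
    · rw [List.concat_eq_append, invRev_append_singleton, List.cons_append, List.cons.injEq,
        List.nil_eq, List.append_eq_nil_iff] at hi
      obtain ⟨ha, ht, rfl⟩ := hi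
      have ht : t = [] := by simpa using congrArg List.length ht
      have ha : a = (i, false) := by rw [← letterInv_letterInv a, ← ha, letterInv, Bool.not_true]
      simp [ht, ha]

theorem almostInvariant_head?_toWord (j : ι) :
    AlmostInvariant {g : FreeGroup ι | g.toWord.head? = some (j, true)} := by
  refine .of_closure_eq_top (closure_range_of ι) ?_
  rintro _ ⟨i, rfl⟩
  filter_upwards [(Set.finite_singleton (1 : FreeGroup ι)).compl_mem_cofinite] with g hg
  exact head?_toWord_mul_of (Or.inr hg)

omit [DecidableEq ι] in
theorem infinite_of_forall_of_pow_succ_mem {A : Set (FreeGroup ι)} (i : ι)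
    (h : ∀ n : ℕ, of i ^ (n + 1) ∈ A) : A.Infinite := by
  classical
  refine Set.infinite_of_injective_forall_mem (fun m n hmn => ?_) h
  simpa [norm_of_pow] using congrArg FreeGroup.norm hmn

omit [DecidableEq ι] in
theorem exists_almostInvariant {F : Type u} [Group F] (B : FreeGroupBasis ι F) {i j : ι}
    (hij : i ≠ j) : ∃ A : Set F, AlmostInvariant A ∧ A.Infinite ∧ Aᶜ.Infinite ∧
      ∀ g, g * B i ∈ A ↔ g ∈ A := by
  classical
  set A : Set (FreeGroup ι) := {g | g.toWord.head? = some (j, true)} with hA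
  have hinf : A.Infinite := infinite_of_forall_of_pow_succ_mem j fun n => by
    simp [hA, toWord_of_pow, List.replicate_succ]
  have hinf' : Aᶜ.Infinite := infinite_of_forall_of_pow_succ_mem i fun n => by
    simp [hA, toWord_of_pow, List.replicate_succ, hij]
  refine ⟨B.repr ⁻¹' A, (almostInvariant_head?_toWord j).preimage B.repr,
    hinf.preimage (by simp [B.repr.surjective.range_eq]),
    hinf'.preimage (by simp [B.repr.surjective.range_eq]), fun g => ?_⟩
  simpa [hA] using head?_toWord_mul_of (g := B.repr g) (Or.inl hij)

end FirstLetter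

section Cone

open FreeGroup

variable {ι : Type u} [DecidableEq ι]

/-- The elements of the free group whose reduced word begins with `W`, that is, the part of the
Cayley tree behind the vertex `W` as seen from the identity. -/
def cone (W : List (ι × Bool)) : Set (FreeGroup ι) := {g | W <+: g.toWord}

theorem isReduced_of_mem_cone {W : List (ι × Bool)} {g : FreeGroup ι} (hg : g ∈ cone W) :
    IsReduced W :=
  isReduced_toWord.infix hg.isInfix

theorem getLast?_ne_of_mem_cone {W : List (ι × Bool)} {z : ι × Bool} {g : FreeGroup ι}
    (hg : g ∈ cone (W ++ [z])) : W.getLast?.map letterInv ≠ some z :=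
  (isReduced_append_cons_iff.1 (isReduced_of_mem_cone hg)).2.2

theorem mk_mul_mk_mem_cone {W T : List (ι × Bool)} {z : ι × Bool} (hW : IsReduced W)
    (hz : W.getLast?.map letterInv ≠ some z) (hT : IsReduced (z :: T)) :
    mk W * mk (z :: T) ∈ cone (W ++ [z]) := by
  refine ⟨T, ?_⟩
  rw [mul_mk, toWord_mk, (isReduced_append_cons_iff.2 ⟨hW, hT, hz⟩).reduce_eq, List.append_assoc,
    List.singleton_append]

theorem cone_nil : cone ([] : List (ι × Bool)) = Set.univ :=
  Set.eq_univ_of_forall fun _ => List.nil_prefix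

theorem cone_subset (W : List (ι × Bool)) : cone W ⊆ {mk W} ∪ ⋃ z, cone (W ++ [z]) := by
  rintro g ⟨T, hT⟩
  cases T with
  | nil => exact Or.inl (by rw [Set.mem_singleton_iff, ← mk_toWord (x := g), ← hT, List.append_nil])
  | cons z T => exact Or.inr (Set.mem_iUnion.2 ⟨z, T, by simp [← hT]⟩)

theorem exists_infinite_cone_inter [Finite ι] {W : List (ι × Bool)} {A : Set (FreeGroup ι)}
    (h : (cone W ∩ A).Infinite) : ∃ z, (cone (W ++ [z]) ∩ A).Infinite := by
  by_contra! hfin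
  refine h (((Set.finite_singleton (mk W)).union (Set.finite_iUnion hfin)).subset ?_)
  rw [← Set.iUnion_inter]
  rintro g ⟨hg, hgA⟩
  exact (cone_subset W hg).imp_right fun hg => ⟨hg, hgA⟩

/-- The set `A` splits the cone of `W` if both `A` and its complement meet it in an infinite set. -/
def SplitsCone (A : Set (FreeGroup ι)) (W : List (ι × Bool)) : Prop :=
  (cone W ∩ A).Infinite ∧ (cone W ∩ Aᶜ).Infinite

theorem AlmostInvariant.exists_norm_le [Finite ι] {A : Set (FreeGroup ι)}
    (hA : AlmostInvariant A) :
    ∃ N : ℕ, ∀ (g : FreeGroup ι) (s : ι × Bool), N < g.norm → (g * mk [s] ∈ A ↔ g ∈ A) := by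
  have hfin := Set.finite_iUnion fun s : ι × Bool => hA (mk [s])
  obtain ⟨N, hN⟩ := (hfin.image FreeGroup.norm).bddAbove
  refine ⟨N, fun g s hg => ?_⟩
  by_contra hgs
  exact hg.not_ge (hN ⟨g, Set.mem_iUnion.2 ⟨s, hgs⟩, rfl⟩)

theorem AlmostInvariant.exists_not_splitsCone [Finite ι] {A : Set (FreeGroup ι)}
    (hA : AlmostInvariant A) :
    ∃ N : ℕ, ∀ W : List (ι × Bool), N < W.length → ¬ SplitsCone A W := by
  obtain ⟨N, hN⟩ := hA.exists_norm_le
  refine ⟨N, fun W hW hsplit => ?_⟩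
  have hword (T : List (ι × Bool)) (hT : IsReduced (W ++ T)) : mk (W ++ T) ∈ A ↔ mk W ∈ A := by
    induction T using List.reverseRecOn with
    | nil => rw [List.append_nil]
    | append_singleton T s ih =>
      have hWT : IsReduced (W ++ T) := hT.infix ⟨[], [s], by simp⟩
      rw [← ih hWT, ← List.append_assoc, ← mul_mk]
      refine hN _ s ?_
      rw [FreeGroup.norm, toWord_mk, hWT.reduce_eq, List.length_append]
      omega
  have hcone (g : FreeGroup ι) (hg : g ∈ cone W) : g ∈ A ↔ mk W ∈ A := by
    obtain ⟨T, hT⟩ := hg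
    have hgT := hword T (hT ▸ isReduced_toWord)
    rwa [hT, mk_toWord] at hgT
  obtain ⟨g, hg, hgA⟩ := hsplit.1.nonempty
  obtain ⟨g', hg', hgA'⟩ := hsplit.2.nonempty
  exact hgA' ((hcone g' hg').2 ((hcone g hg).1 hgA))

theorem AlmostInvariant.exists_maximal_splitsCone [Finite ι] {A : Set (FreeGroup ι)}
    (hA : AlmostInvariant A) (hinf : A.Infinite) (hinf' : Aᶜ.Infinite) :
    ∃ W, SplitsCone A W ∧ ∀ z, ¬ SplitsCone A (W ++ [z]) := by
  by_contra! hext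
  have hsplit (n : ℕ) : ∃ W : List (ι × Bool), W.length = n ∧ SplitsCone A W := by
    induction n with
    | zero => exact ⟨[], rfl, by simpa [cone_nil], by simpa [cone_nil]⟩
    | succ n ih =>
      obtain ⟨W, rfl, hW⟩ := ih
      obtain ⟨z, hz⟩ := hext W hW
      exact ⟨W ++ [z], by simp, hz⟩
  obtain ⟨N, hN⟩ := hA.exists_not_splitsCone
  obtain ⟨W, hWN, hW⟩ := hsplit (N + 1)
  exact hN W (by omega) hW

theorem mk_mul_inv_mul_pow_mem_cone {W X S T : List (ι × Bool)} {z : ι × Bool}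
    (hX : IsCyclicallyReduced X) (hW : IsReduced W) (hz : W.getLast?.map letterInv ≠ some z)
    {n : ℕ} (hST : (List.replicate n X).flatten = S ++ z :: T) (k : ℕ) :
    mk W * (mk S)⁻¹ * mk X ^ (n + k) ∈ cone (W ++ [z]) := by
  have hnk : (List.replicate (n + k) X).flatten =
      S ++ z :: (T ++ (List.replicate k X).flatten) := by
    rw [List.replicate_add, List.flatten_append, hST, List.append_assoc, List.cons_append]
  have hred : IsReduced (z :: (T ++ (List.replicate k X).flatten)) :=
    (hX.flatten_replicate (n + k)).isReduced.infix ⟨S, [], by simp [hnk]⟩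
  rw [pow_mk, hnk, ← mul_mk, mul_assoc, inv_mul_cancel_left]
  exact mk_mul_mk_mem_cone hW hz hred

theorem infinite_cone_inter {W X S T : List (ι × Bool)} {z : ι × Bool} {A : Set (FreeGroup ι)}
    (hX : IsCyclicallyReduced X) (hA : ∀ g, g * mk X ∈ A ↔ g ∈ A) (hW : IsReduced W)
    (hz : W.getLast?.map letterInv ≠ some z) {n : ℕ}
    (hST : (List.replicate n X).flatten = S ++ z :: T) (hmem : mk W * (mk S)⁻¹ ∈ A) :
    (cone (W ++ [z]) ∩ A).Infinite := by
  have hX1 : mk X ≠ 1 := by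
    rw [Ne, ← toWord_eq_nil_iff, toWord_mk, hX.isReduced.reduce_eq]
    rintro rfl
    simp at hST
  have hinj : Function.Injective fun k : ℕ => mk W * (mk S)⁻¹ * mk X ^ (n + k) := fun k l hkl =>
    Nat.add_left_cancel
      (injective_pow_iff_not_isOfFinOrder.2 (not_isOfFinOrder_of_isMulTorsionFree hX1)
        (mul_left_cancel hkl))
  refine Set.infinite_of_injective_forall_mem hinj fun k =>
    ⟨mk_mul_inv_mul_pow_mem_cone hX hW hz hST k, ?_⟩
  exact_mod_cast (mul_zpow_mem_iff hA _ ((n + k : ℕ) : ℤ)).2 hmem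

theorem infinite_cone_inter_letterInv {W X S T : List (ι × Bool)} {a : ι × Bool}
    {A : Set (FreeGroup ι)} (hX : IsCyclicallyReduced X) (hA : ∀ g, g * mk X ∈ A ↔ g ∈ A)
    (hW : IsReduced W) (ha : W.getLast?.map letterInv ≠ some (letterInv a)) {n : ℕ}
    (hST : (List.replicate n X).flatten = S ++ a :: T) (hmem : mk W * (mk (S ++ [a]))⁻¹ ∈ A) :
    (cone (W ++ [letterInv a]) ∩ A).Infinite := by
  have hinv : (List.replicate n (invRev X)).flatten = invRev T ++ letterInv a :: invRev S := by
    rw [← invRev_flatten_replicate, hST, ← List.singleton_append, ← List.append_assoc,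
      invRev_append, invRev_append_singleton]
  have hpow : mk X ^ n = mk (S ++ [a]) * mk T := by simp [pow_mk, hST, mul_mk]
  refine infinite_cone_inter (isCyclicallyReduced_invRev hX) (fun g => ?_) hW ha hinv ?_
  · rw [← inv_mk, ← zpow_neg_one, mul_zpow_mem_iff hA]
  · rw [← inv_mk, inv_inv, ← inv_mul_cancel_left (mk (S ++ [a])) (mk T), ← hpow, ← mul_assoc]
    exact_mod_cast (mul_zpow_mem_iff hA _ (n : ℤ)).2 hmem

theorem letterInv_infinite_cone_inter_iff {W X : List (ι × Bool)} {a z : ι × Bool}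
    {A : Set (FreeGroup ι)} (hX : IsCyclicallyReduced X) (hA : ∀ g, g * mk X ∈ A ↔ g ∈ A)
    (hW : IsReduced W) (hmax : ∀ z, ¬ SplitsCone A (W ++ [z]))
    (ha : W.getLast?.map letterInv ≠ some (letterInv a)) (hz : W.getLast?.map letterInv ≠ some z)
    {n : ℕ} (hinfix : [a, z] <:+: (List.replicate n X).flatten) :
    (cone (W ++ [letterInv a]) ∩ A).Infinite ↔ (cone (W ++ [z]) ∩ A).Infinite := by
  obtain ⟨S, T, hST⟩ := hinfix
  have haT : (List.replicate n X).flatten = S ++ a :: z :: T := by simp [← hST]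
  have hzT : (List.replicate n X).flatten = (S ++ [a]) ++ z :: T := by simp [← hST]
  by_cases hmem : mk W * (mk (S ++ [a]))⁻¹ ∈ A
  · exact iff_of_true (infinite_cone_inter_letterInv hX hA hW ha haT hmem)
      (infinite_cone_inter hX hA hW hz hzT hmem)
  · have hA' (g : FreeGroup ι) : g * mk X ∈ Aᶜ ↔ g ∈ Aᶜ := not_congr (hA g)
    exact iff_of_false
      (fun h => hmax _ ⟨h, infinite_cone_inter_letterInv hX hA' hW ha haT hmem⟩)
      (fun h => hmax _ ⟨h, infinite_cone_inter hX hA' hW hz hzT hmem⟩)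

end Cone

section Cut

open FreeGroup

variable {ι : Type u}

/-- The pairs of cyclically consecutive letters of a word, with repetition. -/
def cyclicPairs {α : Type*} (X : List α) : List (α × α) := X.zip (X.rotate 1)

theorem cyclicPairs_cons {α : Type*} (x : α) (l : List α) :
    cyclicPairs (x :: l) = (x :: l).zip (l ++ [x]) := by
  rw [cyclicPairs, List.rotate_cons_succ, List.rotate_zero]

theorem infix_of_mem_zip {α : Type*} {a z x y : α} {l : List α}
    (h : (a, z) ∈ (x :: l).zip (l ++ [y])) : [a, z] <:+: x :: (l ++ [y]) := by
  induction l generalizing x with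
  | nil => simp_all
  | cons b l ih =>
    rw [List.cons_append, List.zip_cons_cons, List.mem_cons, Prod.mk.injEq] at h
    rcases h with ⟨rfl, rfl⟩ | h
    · exact ⟨[], l ++ [y], by simp⟩
    · exact (ih h).trans (List.suffix_cons _ _).isInfix

theorem infix_append_self_of_mem_cyclicPairs {α : Type*} {X : List α} {a z : α}
    (h : (a, z) ∈ cyclicPairs X) : [a, z] <:+: X ++ X := by
  cases X with
  | nil => simp [cyclicPairs] at h
  | cons x l =>
    rw [cyclicPairs_cons] at h
    exact (infix_of_mem_zip h).trans ⟨[], l, by simp⟩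

/-- The Whitehead graph of a cyclic word `X` has the letters and their inverses as vertices and an
edge from `a⁻¹` to `z` for each pair of cyclically consecutive letters `a z` of `X`. The sets `P`
and `Pᶜ` form a cut of this graph along `D` if removing the vertices `D` leaves no edge between
them, and both retain some vertex. -/
structure IsWhiteheadCut (X : List (ι × Bool)) (D P : Set (ι × Bool)) : Prop where
  nonempty : (P \ D).Nonempty
  nonempty_compl : (Pᶜ \ D).Nonempty
  mem_iff : ∀ a z, (a, z) ∈ cyclicPairs X → letterInv a ∉ D → z ∉ D → (letterInv a ∈ P ↔ z ∈ P)

/-- The key step of Whitehead's cut vertex lemma: the letters that can follow a longest `W` whose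
cone is split by `A` are themselves separated by `A`, the letter leading back from `W` excepted. -/
theorem AlmostInvariant.exists_isWhiteheadCut [Finite ι] {A : Set (FreeGroup ι)}
    (hA : AlmostInvariant A) (hinf : A.Infinite) (hinf' : Aᶜ.Infinite) {X : List (ι × Bool)}
    (hX : IsCyclicallyReduced X) (hAX : ∀ g, g * mk X ∈ A ↔ g ∈ A) :
    ∃ D P : Set (ι × Bool), D.Subsingleton ∧
      ∀ (n : ℕ) (Y : List (ι × Bool)), Y ++ Y <:+: (List.replicate n X).flatten →
        IsWhiteheadCut Y D P := by
  classical
  obtain ⟨W, hW, hmax⟩ := hA.exists_maximal_splitsCone hinf hinf'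
  have hWred : IsReduced W := isReduced_of_mem_cone hW.1.nonempty.some_mem.1
  refine ⟨{z | W.getLast?.map letterInv = some z}, {z | (cone (W ++ [z]) ∩ A).Infinite},
    fun a ha b hb => Option.some_injective _ (ha.symm.trans hb), fun n Y hY => ⟨?_, ?_, ?_⟩⟩
  · obtain ⟨z, hz⟩ := exists_infinite_cone_inter hW.1
    exact ⟨z, hz, getLast?_ne_of_mem_cone hz.nonempty.some_mem.1⟩
  · obtain ⟨z, hz⟩ := exists_infinite_cone_inter hW.2
    exact ⟨z, fun h => hmax z ⟨h, hz⟩, getLast?_ne_of_mem_cone hz.nonempty.some_mem.1⟩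
  · exact fun a z haz ha hz => letterInv_infinite_cone_inter_iff hX hAX hWred hmax ha hz
      ((infix_append_self_of_mem_cyclicPairs haz).trans hY)

end Cut

section CyclicProduct

variable {α : Type*} {G : Type u} [Group G]

theorem mul_prod_map_zip (u v : α → G) (x y : α) (l : List α) :
    u x * (((x :: l).zip (l ++ [y])).map fun p => v p.1 * u p.2).prod =
      ((x :: l).map fun z => u z * v z).prod * u y := by
  induction l generalizing x with
  | nil => simp [mul_assoc]
  | cons b l ih =>
    simp only [List.cons_append, List.zip_cons_cons, List.map_cons, List.prod_cons,
      mul_assoc] at ih ⊢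
    rw [ih]

theorem isConj_prod_map_cyclicPairs (u v : α → G) (X : List α) :
    IsConj (X.map fun z => u z * v z).prod
      ((cyclicPairs X).map fun p => v p.1 * u p.2).prod := by
  cases X with
  | nil => rfl
  | cons x l =>
    rw [isConj_comm, isConj_iff, cyclicPairs_cons]
    exact ⟨u x, mul_inv_eq_of_eq_mul (mul_prod_map_zip u v x x l)⟩

theorem map_fst_cyclicPairs (X : List α) : (cyclicPairs X).map Prod.fst = X := by
  simp [cyclicPairs, List.map_fst_zip]

theorem map_snd_cyclicPairs (X : List α) : (cyclicPairs X).map Prod.snd = X.rotate 1 := by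
  simp [cyclicPairs, List.map_snd_zip]

end CyclicProduct

section Whitehead

open FreeGroup

variable {ι : Type u} [DecidableEq ι]

/-- The endomorphism of a free group that multiplies each letter `y` other than `d` and its inverse
by `d ^ χ y` from the left and by the inverse of `d ^ χ y⁻¹` from the right. -/
def whiteheadHom (d : ι × Bool) (χ : ι × Bool → ℤ) : FreeGroup ι →* FreeGroup ι :=
  FreeGroup.lift fun i => if i = d.1 then of i else
    mk [d] ^ χ (i, true) * of i * mk [d] ^ (-χ (i, false))

omit [DecidableEq ι] in
theorem mk_singleton_letterInv (a : ι × Bool) : mk [letterInv a] = (mk [a])⁻¹ := by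
  rw [inv_mk]
  rfl

theorem whiteheadHom_self (d : ι × Bool) (χ : ι × Bool → ℤ) :
    whiteheadHom d χ (mk [d]) = mk [d] := by
  obtain ⟨i, b⟩ := d
  cases b <;> simp [whiteheadHom, of, inv_mk, invRev]

theorem whiteheadHom_of {d : ι × Bool} {i : ι} (hi : i ≠ d.1) (χ : ι × Bool → ℤ) :
    whiteheadHom d χ (of i) = mk [d] ^ χ (i, true) * of i * mk [d] ^ (-χ (i, false)) := by
  rw [whiteheadHom, lift_apply_of, if_neg hi]

theorem whiteheadHom_comp_neg (d : ι × Bool) (χ : ι × Bool → ℤ) :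
    (whiteheadHom d χ).comp (whiteheadHom d (-χ)) = MonoidHom.id _ := by
  ext i
  by_cases hi : i = d.1
  · simp [whiteheadHom, hi]
  · rw [MonoidHom.comp_apply, whiteheadHom_of hi, _root_.map_mul, _root_.map_mul, map_zpow,
      map_zpow, whiteheadHom_self, whiteheadHom_of hi, MonoidHom.id_apply, Pi.neg_apply,
      Pi.neg_apply]
    group

/-- The Whitehead automorphism with multiplier `d` and exponents `χ`. -/
def whiteheadEquiv (d : ι × Bool) (χ : ι × Bool → ℤ) : FreeGroup ι ≃* FreeGroup ι :=
  MonoidHom.toMulEquiv (whiteheadHom d χ) (whiteheadHom d (-χ))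
    (by simpa using whiteheadHom_comp_neg d (-χ)) (whiteheadHom_comp_neg d χ)

/-- What remains of the letter `y` in its image under a Whitehead automorphism with multiplier `d`
once the powers of `d` are split off. -/
def whiteheadCore (d y : ι × Bool) : FreeGroup ι := if y.1 = d.1 then 1 else mk [y]

theorem whiteheadHom_mk_singleton {d : ι × Bool} {χ : ι × Bool → ℤ} (hd : χ d = 1)
    (hd' : χ (letterInv d) = 0) (y : ι × Bool) :
    whiteheadHom d χ (mk [y]) =
      mk [d] ^ χ y * whiteheadCore d y * mk [d] ^ (-χ (letterInv y)) := by
  by_cases hy : y.1 = d.1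
  · have hyd : y = d ∨ y = letterInv d := by
      by_cases h : y.2 = d.2
      · exact Or.inl (Prod.ext hy h)
      · exact Or.inr (Prod.ext hy (Bool.eq_not.2 h))
    rcases hyd with rfl | rfl
    · simp [whiteheadHom_self, whiteheadCore, hd, hd']
    · rw [letterInv_letterInv, hd, hd', mk_singleton_letterInv, _root_.map_inv, whiteheadHom_self,
        whiteheadCore, if_pos hy, zpow_zero, one_mul, one_mul, zpow_neg_one]
  · rw [whiteheadCore, if_neg hy]
    obtain ⟨i, b⟩ := y
    have hof := whiteheadHom_of hy χ
    cases b with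
    | true => exact hof
    | false =>
      rw [show mk [(i, false)] = (of i)⁻¹ from mk_singleton_letterInv (i, true), _root_.map_inv,
        hof, letterInv, Bool.not_false]
      group

omit [DecidableEq ι] in
theorem prod_map_mk_singleton (X : List (ι × Bool)) : (X.map fun y => mk [y]).prod = mk X := by
  induction X with
  | nil => rfl
  | cons y X ih => rw [List.map_cons, List.prod_cons, ih, mul_mk, List.singleton_append]

theorem isConj_whiteheadHom_mk {d : ι × Bool} {χ : ι × Bool → ℤ} (hd : χ d = 1)
    (hd' : χ (letterInv d) = 0) (X : List (ι × Bool)) :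
    IsConj (whiteheadHom d χ (mk X)) ((cyclicPairs X).map fun p =>
      mk [d] ^ (χ p.2 - χ (letterInv p.1)) * whiteheadCore d p.2).prod := by
  have hconj := isConj_prod_map_cyclicPairs (fun z => mk [d] ^ χ z * whiteheadCore d z)
    (fun a => mk [d] ^ (-χ (letterInv a))) X
  rw [← prod_map_mk_singleton, map_list_prod, List.map_map]
  simpa only [← mul_assoc, ← zpow_add, neg_add_eq_sub, Function.comp_def,
    whiteheadHom_mk_singleton hd hd'] using hconj

theorem norm_whiteheadCore_add_le (d z : ι × Bool) :
    (whiteheadCore d z).norm + (if letterInv z = d then 1 else 0) ≤ 1 := by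
  have hle : (mk [z]).norm ≤ 1 := norm_mk_le
  by_cases hz : z.1 = d.1
  · rw [whiteheadCore, if_pos hz, FreeGroup.norm_one]
    split_ifs <;> simp
  · have hz' : letterInv z ≠ d := fun h => hz (h ▸ rfl)
    simpa [whiteheadCore, hz, hz'] using hle

theorem norm_whiteheadCore_self_add (d : ι × Bool) :
    (whiteheadCore d d).norm + (if letterInv d = d then 1 else 0) = 0 := by
  simp [whiteheadCore, letterInv_ne]

section Length

variable {d a z : ι × Bool} {Q : Set (ι × Bool)}

theorem norm_zpow_indicator_sub_mul_le (d a z : ι × Bool) (Q : Set (ι × Bool)) (g : FreeGroup ι) :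
    (mk [d] ^ (Q.indicator 1 z - Q.indicator 1 a : ℤ) * g).norm ≤ 1 + g.norm := by
  have hle : (mk [d]).norm ≤ 1 := norm_mk_le
  refine (FreeGroup.norm_mul_le _ _).trans (Nat.add_le_add_right ?_ _)
  by_cases ha : a ∈ Q <;> by_cases hz : z ∈ Q <;> simp [ha, hz, hle, -inv_mk]

omit [DecidableEq ι] in
theorem zpow_indicator_sub_mul_of_iff (h : a ∈ Q ↔ z ∈ Q) (g : FreeGroup ι) :
    mk [d] ^ (Q.indicator 1 z - Q.indicator 1 a : ℤ) * g = g := by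
  by_cases hz : z ∈ Q <;> simp [h, hz]

theorem norm_whitehead_pair_le (hcut : a ≠ d → z ≠ d → (a ∈ Q ↔ z ∈ Q)) :
    (mk [d] ^ (Q.indicator 1 z - Q.indicator 1 a : ℤ) * whiteheadCore d z).norm +
      (if letterInv z = d then 1 else 0) ≤ 1 + if a = d then 1 else 0 := by
  have hcore := norm_whiteheadCore_add_le d z
  by_cases h : a ∈ Q ↔ z ∈ Q
  · rw [zpow_indicator_sub_mul_of_iff h]
    omega
  · have hle := norm_zpow_indicator_sub_mul_le d a z Q (whiteheadCore d z)
    by_cases ha : a = d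
    · rw [if_pos ha]
      omega
    · obtain rfl : z = d := by
        by_contra hz
        exact h (hcut ha hz)
      have hself := norm_whiteheadCore_self_add z
      omega

theorem norm_whitehead_pair_lt (h : a ∈ Q ↔ z ∈ Q) (hd : a = d ∨ z = d) :
    (mk [d] ^ (Q.indicator 1 z - Q.indicator 1 a : ℤ) * whiteheadCore d z).norm +
      (if letterInv z = d then 1 else 0) < 1 + if a = d then 1 else 0 := by
  rw [zpow_indicator_sub_mul_of_iff h]
  rcases hd with rfl | rfl
  · have hcore := norm_whiteheadCore_add_le a z
    rw [if_pos rfl]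
    omega
  · have hself := norm_whiteheadCore_self_add z
    omega

theorem sum_norm_whitehead_pair_lt {X : List (ι × Bool)}
    (hcut : ∀ a z, (a, z) ∈ cyclicPairs X → letterInv a ≠ d → z ≠ d → (letterInv a ∈ Q ↔ z ∈ Q))
    (haz : (a, z) ∈ cyclicPairs X) (hd : letterInv a = d ∨ z = d)
    (hQ : letterInv a ∈ Q ↔ z ∈ Q) :
    ((cyclicPairs X).map fun p => (mk [d] ^ (Q.indicator 1 p.2 - Q.indicator 1 (letterInv p.1) : ℤ)
      * whiteheadCore d p.2).norm).sum < X.length := by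
  have hlt := List.sum_lt_sum
    (fun p : (ι × Bool) × (ι × Bool) =>
      (mk [d] ^ (Q.indicator 1 p.2 - Q.indicator 1 (letterInv p.1) : ℤ) *
        whiteheadCore d p.2).norm + if letterInv p.2 = d then 1 else 0)
    (fun p => 1 + if letterInv p.1 = d then 1 else 0)
    (fun p hp => norm_whitehead_pair_le (hcut p.1 p.2 hp)) ⟨_, haz, norm_whitehead_pair_lt hQ hd⟩
  have hsum : ((cyclicPairs X).map fun p => if letterInv p.2 = d then 1 else 0).sum =
      ((cyclicPairs X).map fun p => if letterInv p.1 = d then 1 else 0).sum := by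
    set f : ι × Bool → ℕ := fun y => if letterInv y = d then 1 else 0
    change ((cyclicPairs X).map (f ∘ Prod.snd)).sum = ((cyclicPairs X).map (f ∘ Prod.fst)).sum
    rw [← List.map_map, ← List.map_map, map_fst_cyclicPairs, map_snd_cyclicPairs]
    exact ((List.rotate_perm X 1).map f).sum_eq
  rw [List.sum_map_add, List.sum_map_add, hsum] at hlt
  simpa [cyclicPairs] using hlt

theorem exists_norm_lt {x : FreeGroup ι} (hd : d ∈ Q) (hd' : letterInv d ∉ Q)
    (hcut : ∀ a z, (a, z) ∈ cyclicPairs x.toWord → letterInv a ≠ d → z ≠ d →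
      (letterInv a ∈ Q ↔ z ∈ Q))
    (haz : (a, z) ∈ cyclicPairs x.toWord) (hazd : letterInv a = d ∨ z = d)
    (hQ : letterInv a ∈ Q ↔ z ∈ Q) : ∃ e : FreeGroup ι ≃* FreeGroup ι, (e x).norm < x.norm := by
  set χ : ι × Bool → ℤ := Q.indicator 1
  obtain ⟨c, hc⟩ := isConj_iff.1 (isConj_whiteheadHom_mk (χ := χ) (Set.indicator_of_mem hd 1)
    (Set.indicator_of_notMem hd' 1) x.toWord)
  refine ⟨(whiteheadEquiv d χ).trans (MulAut.conj c), ?_⟩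
  calc (((whiteheadEquiv d χ).trans (MulAut.conj c)) x).norm
      = ((cyclicPairs x.toWord).map fun p =>
          mk [d] ^ (χ p.2 - χ (letterInv p.1)) * whiteheadCore d p.2).prod.norm := by
        rw [← hc, mk_toWord]
        rfl
    _ ≤ _ := List.apply_prod_le_sum_map _ FreeGroup.norm FreeGroup.norm_one.le
        FreeGroup.norm_mul_le
    _ < x.toWord.length := by
        rw [List.map_map]
        exact sum_norm_whitehead_pair_lt hcut haz hazd hQ

end Length

end Whitehead

section Minimal

open FreeGroup

variable {ι : Type u}

theorem exists_mem_cyclicPairs_left {α : Type*} {X : List α} {z : α} (hz : z ∈ X) :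
    ∃ a, (a, z) ∈ cyclicPairs X := by
  rw [← List.mem_rotate (n := 1), ← map_snd_cyclicPairs] at hz
  obtain ⟨⟨a, _⟩, haz, rfl⟩ := List.mem_map.1 hz
  exact ⟨a, haz⟩

theorem exists_mem_cyclicPairs_right {α : Type*} {X : List α} {a : α} (ha : a ∈ X) :
    ∃ z, (a, z) ∈ cyclicPairs X := by
  rw [← map_fst_cyclicPairs X] at ha
  obtain ⟨⟨_, z⟩, haz, rfl⟩ := List.mem_map.1 ha
  exact ⟨z, haz⟩

theorem mem_iff_of_mem_zip {α : Type*} {P : Set α} {x y : α} {l : List α}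
    (h : ∀ a z, (a, z) ∈ (x :: l).zip (l ++ [y]) → (a ∈ P ↔ z ∈ P)) {b : α} (hb : b ∈ l) :
    b ∈ P ↔ x ∈ P := by
  induction l generalizing x with
  | nil => simp at hb
  | cons c l ih =>
    have hc : x ∈ P ↔ c ∈ P := h x c (by simp)
    rcases List.mem_cons.1 hb with rfl | hb
    · exact hc.symm
    · rw [ih (fun a z haz => h a z (List.mem_cons_of_mem _ haz)) hb, hc]

theorem mem_iff_of_mem_cyclicPairs {α : Type*} {P : Set α} {X : List α}
    (h : ∀ a z, (a, z) ∈ cyclicPairs X → (a ∈ P ↔ z ∈ P)) {b c : α} (hb : b ∈ X) (hc : c ∈ X) :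
    b ∈ P ↔ c ∈ P := by
  cases X with
  | nil => simp at hb
  | cons x l =>
    rw [cyclicPairs_cons] at h
    have hx {b : α} (hb : b ∈ x :: l) : b ∈ P ↔ x ∈ P := by
      rcases List.mem_cons.1 hb with rfl | hb
      exacts [Iff.rfl, mem_iff_of_mem_zip h hb]
    rw [hx hb, hx hc]

theorem IsWhiteheadCut.compl {X : List (ι × Bool)} {D P : Set (ι × Bool)}
    (h : IsWhiteheadCut X D P) : IsWhiteheadCut X D Pᶜ :=
  ⟨h.nonempty_compl, by simpa using h.nonempty,
    fun a z haz ha hz => not_congr (h.mem_iff a z haz ha hz)⟩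

/-- An element of a free group that is shortest in its orbit under the automorphism group. -/
def IsAutMinimal [DecidableEq ι] (x : FreeGroup ι) : Prop :=
  ∀ e : FreeGroup ι ≃* FreeGroup ι, x.norm ≤ (e x).norm

variable [DecidableEq ι] {x : FreeGroup ι} {P : Set (ι × Bool)}

theorem IsAutMinimal.not_mem_iff (hmin : IsAutMinimal x) {d : ι × Bool} (hd : d ∈ P)
    (hd' : letterInv d ∉ P)
    (hcut : ∀ a z, (a, z) ∈ cyclicPairs x.toWord → letterInv a ≠ d → z ≠ d →
      (letterInv a ∈ P ↔ z ∈ P)) {a z : ι × Bool} (haz : (a, z) ∈ cyclicPairs x.toWord)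
    (hazd : letterInv a = d ∨ z = d) : ¬ (letterInv a ∈ P ↔ z ∈ P) := by
  intro hP
  obtain ⟨e, he⟩ := exists_norm_lt hd hd' hcut haz hazd hP
  exact (hmin e).not_gt he

omit [DecidableEq ι] in
theorem mem_or_letterInv_mem {X : List (ι × Bool)} (hX : ∀ i, ∃ b, (i, b) ∈ X) (a : ι × Bool) :
    a ∈ X ∨ letterInv a ∈ X := by
  obtain ⟨i, b⟩ := a
  obtain ⟨b', hb'⟩ := hX i
  cases b <;> cases b' <;> simp [letterInv, hb']

theorem IsAutMinimal.letterInv_mem (hmin : IsAutMinimal x) (hx : ∀ i, ∃ b, (i, b) ∈ x.toWord)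
    (hcut : IsWhiteheadCut x.toWord ∅ P) {d : ι × Bool} (hd : d ∈ P) : letterInv d ∈ P := by
  by_contra hd'
  have hiff (a z : ι × Bool) (haz : (a, z) ∈ cyclicPairs x.toWord) : letterInv a ∈ P ↔ z ∈ P :=
    hcut.mem_iff a z haz (Set.notMem_empty _) (Set.notMem_empty _)
  have hnot (a z : ι × Bool) (haz : (a, z) ∈ cyclicPairs x.toWord) : ¬ (letterInv a = d ∨ z = d) :=
    fun hazd => hmin.not_mem_iff hd hd' (fun a z haz _ _ => hiff a z haz) haz hazd (hiff a z haz)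
  rcases mem_or_letterInv_mem hx d with h | h
  · obtain ⟨a, haz⟩ := exists_mem_cyclicPairs_left h
    exact hnot a d haz (Or.inr rfl)
  · obtain ⟨z, haz⟩ := exists_mem_cyclicPairs_right h
    exact hnot _ z haz (Or.inl (letterInv_letterInv d))

theorem IsAutMinimal.not_isWhiteheadCut_empty (hmin : IsAutMinimal x)
    (hx : ∀ i, ∃ b, (i, b) ∈ x.toWord) : ¬ IsWhiteheadCut x.toWord ∅ P := by
  intro hcut
  have hinv (a : ι × Bool) : letterInv a ∈ P ↔ a ∈ P :=
    ⟨fun h => letterInv_letterInv a ▸ hmin.letterInv_mem hx hcut h, hmin.letterInv_mem hx hcut⟩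
  have hocc (a : ι × Bool) : ∃ y ∈ x.toWord, y ∈ P ↔ a ∈ P := by
    rcases mem_or_letterInv_mem hx a with h | h
    exacts [⟨a, h, Iff.rfl⟩, ⟨_, h, hinv a⟩]
  obtain ⟨p, hp, -⟩ := hcut.nonempty
  obtain ⟨p', hp', -⟩ := hcut.nonempty_compl
  obtain ⟨y, hy, hyp⟩ := hocc p
  obtain ⟨y', hy', hyp'⟩ := hocc p'
  have hyy' : y ∈ P ↔ y' ∈ P := mem_iff_of_mem_cyclicPairs (fun a z haz => by
    rw [← hinv a]
    exact hcut.mem_iff a z haz (Set.notMem_empty _) (Set.notMem_empty _)) hy hy'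
  exact hp' (hyp'.1 (hyy'.1 (hyp.2 hp)))

theorem IsAutMinimal.not_isWhiteheadCut_singleton (hmin : IsAutMinimal x)
    (hx : ∀ i, ∃ b, (i, b) ∈ x.toWord) {v : ι × Bool} (hv : letterInv v ∉ P) :
    ¬ IsWhiteheadCut x.toWord {v} P := by
  intro hcut
  have hnot (a z : ι × Bool) (haz : (a, z) ∈ cyclicPairs x.toWord)
      (hazv : letterInv a = v ∨ z = v) : ¬ (letterInv a ∈ insert v P ↔ z ∈ insert v P) := by
    refine hmin.not_mem_iff (Set.mem_insert v P) ?_ (fun a z haz ha hz => ?_) haz hazv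
    · exact fun h => h.elim (letterInv_ne v) hv
    · rw [Set.mem_insert_iff, Set.mem_insert_iff, or_iff_right ha, or_iff_right hz]
      exact hcut.mem_iff a z haz ha hz
  refine hmin.not_isWhiteheadCut_empty (P := P \ {v}) hx
    ⟨by simpa using hcut.nonempty, ⟨v, by simp⟩, fun a z haz _ _ => ?_⟩
  by_cases hazv : letterInv a = v ∨ z = v
  · have hins := hnot a z haz hazv
    simp only [Set.mem_insert_iff, Set.mem_sdiff, Set.mem_singleton_iff] at hins ⊢
    tauto
  · obtain ⟨ha, hz⟩ := not_or.1 hazv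
    rw [Set.mem_sdiff, Set.mem_sdiff, Set.mem_singleton_iff, Set.mem_singleton_iff,
      and_iff_left ha, and_iff_left hz]
    exact hcut.mem_iff a z haz ha hz

theorem IsAutMinimal.not_isWhiteheadCut (hmin : IsAutMinimal x)
    (hx : ∀ i, ∃ b, (i, b) ∈ x.toWord) {D : Set (ι × Bool)} (hD : D.Subsingleton) :
    ¬ IsWhiteheadCut x.toWord D P := by
  rcases hD.eq_empty_or_singleton with rfl | ⟨v, rfl⟩
  · exact hmin.not_isWhiteheadCut_empty hx
  · intro hcut
    by_cases hv : letterInv v ∈ P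
    · exact hmin.not_isWhiteheadCut_singleton hx (not_not.2 hv) hcut.compl
    · exact hmin.not_isWhiteheadCut_singleton hx hv hcut

end Minimal

section CyclicReduction

open FreeGroup

variable {ι : Type u}

theorem conj_eq_mk_reduceCyclically [DecidableEq ι] (x : FreeGroup ι) :
    (mk (reduceCyclically.conjugator x.toWord))⁻¹ * x * mk (reduceCyclically.conjugator x.toWord) =
      mk (reduceCyclically x.toWord) := by
  have hx : mk (reduceCyclically.conjugator x.toWord) * mk (reduceCyclically x.toWord) *
      (mk (reduceCyclically.conjugator x.toWord))⁻¹ = x := by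
    rw [inv_mk, mul_mk, mul_mk, reduceCyclically.conj_conjugator_reduceCyclically, mk_toWord]
  nth_rw 2 [← hx]
  group

theorem exists_isCyclicallyReduced_conj {F : Type u} [Group F] (B : FreeGroupBasis ι F) (p : F) :
    ∃ g, IsCyclicallyReduced (reducedWord B (g * p * g⁻¹)) := by
  classical
  refine ⟨B.repr.symm (mk (reduceCyclically.conjugator (B.repr p).toWord))⁻¹, ?_⟩
  have hred := reduceCyclically.isCyclicallyReduced (isReduced_toWord (x := B.repr p))
  rw [reducedWord, _root_.map_mul, _root_.map_mul, ← _root_.map_inv, inv_inv,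
    MulEquiv.apply_symm_apply, MulEquiv.apply_symm_apply, conj_eq_mk_reduceCyclically, toWord_mk,
    hred.isReduced.reduce_eq]
  exact hred

theorem IsAutMinimal.isCyclicallyReduced [DecidableEq ι] {x : FreeGroup ι}
    (hmin : IsAutMinimal x) : IsCyclicallyReduced x.toWord := by
  set g := reduceCyclically.conjugator x.toWord
  have hword : g ++ reduceCyclically x.toWord ++ invRev g = x.toWord :=
    reduceCyclically.conj_conjugator_reduceCyclically x.toWord
  have hle : x.norm ≤ (reduceCyclically x.toWord).length := by
    refine (hmin (MulAut.conj (mk g)⁻¹)).trans ?_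
    rw [MulAut.conj_apply, inv_inv, conj_eq_mk_reduceCyclically]
    exact norm_mk_le
  have hlen := congrArg List.length hword
  have hnil : g = [] := by
    rw [List.length_append, List.length_append, invRev_length] at hlen
    rw [FreeGroup.norm] at hle
    exact List.length_eq_zero_iff.1 (by omega)
  rw [hnil, List.nil_append, invRev_empty, List.append_nil] at hword
  exact hword ▸ reduceCyclically.isCyclicallyReduced isReduced_toWord

end CyclicReduction

section Generators

open FreeGroup

variable {ι : Type u}

theorem mk_mem_closure_image_of {s : Set ι} {L : List (ι × Bool)} (hL : ∀ y ∈ L, y.1 ∈ s) :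
    mk L ∈ Subgroup.closure (of '' s) := by
  induction L with
  | nil => exact Subgroup.one_mem _
  | cons y L ih =>
    obtain ⟨i, b⟩ := y
    obtain ⟨hi, hL⟩ := List.forall_mem_cons.1 hL
    have hof : of i ∈ Subgroup.closure (of '' s) := Subgroup.subset_closure ⟨i, hi, rfl⟩
    rw [← List.singleton_append, ← mul_mk]
    refine Subgroup.mul_mem _ ?_ (ih hL)
    cases b with
    | true => exact hof
    | false => exact Subgroup.inv_mem _ hof

variable {F : Type u} [Group F]

theorem mem_closure_image_of_reducedWord (B : FreeGroupBasis ι F) {s : Set ι} {x : F}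
    (hs : ∀ y ∈ reducedWord B x, y.1 ∈ s) : x ∈ Subgroup.closure (B '' s) := by
  classical
  have hmap := Subgroup.mem_map_of_mem B.repr.symm.toMonoidHom (mk_mem_closure_image_of hs)
  rw [MonoidHom.map_closure, Set.image_image, reducedWord, mk_toWord] at hmap
  simpa only [MulEquiv.coe_toMonoidHom, MulEquiv.symm_apply_apply] using! hmap

theorem exists_mem_reducedWord_of_not_isSeparable (B : FreeGroupBasis ι F) {x : F}
    (hx : ¬ IsSeparable x) (i : ι) : ∃ b, (i, b) ∈ reducedWord B x := by
  by_contra! hi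
  refine hx (isSeparable_of_mem_closure_image B (s := {i}ᶜ) (by simp)
    (mem_closure_image_of_reducedWord B ?_))
  rintro ⟨j, b⟩ hj rfl
  exact hi b hj

theorem finite_of_forall_exists_mem {L : List (ι × Bool)} (hL : ∀ i, ∃ b, (i, b) ∈ L) :
    Finite ι := by
  refine Set.finite_univ_iff.1 ((L.map Prod.fst).finite_toSet.subset fun i _ => ?_)
  obtain ⟨b, hb⟩ := hL i
  exact List.mem_map.2 ⟨_, hb, rfl⟩

end Generators

section Primitive

open FreeGroup

variable {ι : Type u}

open Classical in
theorem exists_isAutMinimal_repr {F : Type u} [Group F] [IsFreeGroup F] (x : F) :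
    ∃ B : FreeGroupBasis (IsFreeGroup.Generators F) F, IsAutMinimal (B.repr x) := by
  obtain ⟨B, -, hB⟩ := WellFounded.has_min
    (measure fun B : FreeGroupBasis (IsFreeGroup.Generators F) F => (B.repr x).norm).wf Set.univ
    ⟨IsFreeGroup.basis F, trivial⟩
  exact ⟨B, fun e => not_lt.1 (hB (FreeGroupBasis.ofRepr (B.repr.trans e)) trivial)⟩

theorem IsAutMinimal.not_infix_of_isPrimitive [DecidableEq ι] [Finite ι] [Nontrivial ι]
    {x c : FreeGroup ι} (hmin : IsAutMinimal x) (hx : ∀ i, ∃ b, (i, b) ∈ x.toWord)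
    (hc : IsPrimitive c) (hc' : IsCyclicallyReduced c.toWord) (n : ℕ) :
    ¬ x.toWord ++ x.toWord <:+: (List.replicate n c.toWord).flatten := by
  obtain ⟨κ, B, i, rfl⟩ := hc
  have : Nontrivial κ := (Equiv.ofFreeGroupEquiv B.repr).symm.nontrivial
  obtain ⟨j, hj⟩ := exists_ne i
  obtain ⟨A, hA, hinf, hinf', hAi⟩ := exists_almostInvariant B hj.symm
  obtain ⟨D, P, hD, hcut⟩ :=
    hA.exists_isWhiteheadCut hinf hinf' hc' (by simpa only [mk_toWord] using hAi)
  exact fun h => hmin.not_isWhiteheadCut hx hD (hcut n _ h)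

variable {F : Type u} [Group F] {B : FreeGroupBasis ι F} {q : F → ℝ}

theorem homogenization_brooks_nonpos {w p : F} (hp : IsCyclicallyReduced (reducedWord B p))
    (hw : ∀ n, ¬ reducedWord B w <:+: (List.replicate n (reducedWord B p)).flatten)
    (hq : IsHomogenization (brooks B w) q) : q p ≤ 0 := by
  refine le_of_tendsto (hq p) (Filter.Eventually.of_forall fun n => ?_)
  have hocc : occurrences (reducedWord B w) (reducedWord B (p ^ n)) = 0 := by
    rw [occurrences_eq_zero_iff, reducedWord_pow B hp]
    exact hw n
  rw [brooks, hocc, Nat.cast_zero, zero_sub]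
  exact div_nonpos_of_nonpos_of_nonneg (neg_nonpos.2 (Nat.cast_nonneg _)) (Nat.cast_nonneg n)

open Classical in
theorem homogenization_brooks_sq_nonpos_of_isPrimitive [Finite ι] [Nontrivial ι] {x p : F}
    (hmin : IsAutMinimal (B.repr x)) (hx : ∀ i, ∃ b, (i, b) ∈ reducedWord B x)
    (hq : IsHomogenization (brooks B (x ^ 2)) q) (hq' : IsHomogeneousQuasimorphism q)
    (hp : IsPrimitive p) : q p ≤ 0 := by
  obtain ⟨g, hg⟩ := exists_isCyclicallyReduced_conj B p
  rw [← hq'.map_conj g p]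
  refine homogenization_brooks_nonpos hg (fun n => ?_) hq
  rw [reducedWord_pow B hmin.isCyclicallyReduced]
  rw [List.replicate_succ, List.replicate_one, List.flatten_cons, List.flatten_singleton]
  exact hmin.not_infix_of_isPrimitive hx ((hp.conj g).map B.repr) hg n

end Primitive

section RankOne

variable {ι F : Type u} [Group F] [Subsingleton ι]

theorem zpowers_basis_eq_top (B : FreeGroupBasis ι F) (i : ι) :
    Subgroup.zpowers (B i) = ⊤ := by
  have := uniqueOfSubsingleton i
  rw [Subgroup.zpowers_eq_closure, ← closure_range_basis B, Set.range_unique,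
    Subsingleton.elim default i]

theorem IsPrimitive.eq_or_eq_inv_of_subsingleton (B : FreeGroupBasis ι F) (i : ι) {p : F}
    (hp : IsPrimitive p) : p = B i ∨ p = (B i)⁻¹ := by
  obtain ⟨κ, B', k, rfl⟩ := hp
  have : Subsingleton κ := (Equiv.ofFreeGroupEquiv (B.repr.symm.trans B'.repr)).symm.subsingleton
  have hfin : ¬ IsOfFinOrder (B i) := fun h => by
    have hof := MonoidHom.isOfFinOrder B.repr.toMonoidHom h
    rw [MulEquiv.coe_toMonoidHom, FreeGroupBasis.repr_apply_coe] at hof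
    exact not_isOfFinOrder_of_isMulTorsionFree (FreeGroup.of_ne_one i) hof
  have htop := (zpowers_basis_eq_top B i).trans (zpowers_basis_eq_top B' k).symm
  rcases (Subgroup.zpowers_eq_zpowers_iff hfin).1 htop with h | h
  · exact Or.inl h.symm
  · exact Or.inr h.symm

end RankOne

section Main

open FreeGroup

variable {ι F : Type u} [Group F]

open Classical in
theorem exists_abs_homogenization_brooks_sq_le {B : FreeGroupBasis ι F} [Nonempty ι] {x : F}
    (hmin : IsAutMinimal (B.repr x)) (hx : ∀ i, ∃ b, (i, b) ∈ reducedWord B x) {q : F → ℝ}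
    (hq : IsHomogenization (brooks B (x ^ 2)) q) (hq' : IsHomogeneousQuasimorphism q) :
    ∃ C : ℝ, ∀ p : F, IsPrimitive p → |q p| ≤ C := by
  rcases subsingleton_or_nontrivial ι with hsub | hnontriv
  · obtain ⟨i⟩ := ‹Nonempty ι›
    refine ⟨|q (B i)|, fun p hp => ?_⟩
    rcases hp.eq_or_eq_inv_of_subsingleton B i with rfl | rfl
    · exact le_rfl
    · rw [hq'.map_inv, abs_neg]
  · have := finite_of_forall_exists_mem hx
    have hnonpos {p : F} : IsPrimitive p → q p ≤ 0 :=
      homogenization_brooks_sq_nonpos_of_isPrimitive hmin hx hq hq'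
    refine ⟨0, fun p hp => ?_⟩
    have hinv := hnonpos hp.inv
    rw [hq'.map_inv] at hinv
    exact abs_le.2 ⟨by linarith, hnonpos hp⟩

theorem exists_isHomogeneousQuasimorphism_of_not_isSeparable [IsFreeGroup F] [Nontrivial F] {x : F}
    (hx : ¬ IsSeparable x) :
    ∃ (ι : Type u) (B : FreeGroupBasis ι F) (q : F → ℝ),
      IsCyclicallyReduced (reducedWord B x) ∧ IsHomogenization (brooks B (x ^ 2)) q ∧
      IsHomogeneousQuasimorphism q ∧ (∃ C : ℝ, ∀ p : F, IsPrimitive p → |q p| ≤ C) ∧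
      q x ≠ 0 := by
  classical
  obtain ⟨B, hmin⟩ := exists_isAutMinimal_repr x
  have hall := exists_mem_reducedWord_of_not_isSeparable B hx
  have hne : Nonempty (IsFreeGroup.Generators F) := nonempty_of_freeGroupBasis B
  have hx1 : x ≠ 1 := by
    rintro rfl
    obtain ⟨b, hb⟩ := hall hne.some
    simp [reducedWord] at hb
  have hx2 : x ^ 2 ≠ 1 := by
    rw [← B.repr.map_ne_one_iff, map_pow, Ne, pow_eq_one_iff_left two_ne_zero]
    exact B.repr.map_ne_one_iff.2 hx1
  have hbr := isQuasimorphism_brooks B hx2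
  obtain ⟨q, hq⟩ := hbr.exists_isHomogenization
  have hq' := hq.isHomogeneousQuasimorphism hbr
  have hqx := one_le_homogenization_brooks_sq B hmin.isCyclicallyReduced hx1 hq
  exact ⟨_, B, q, hmin.isCyclicallyReduced, hq, hq',
    exists_abs_homogenization_brooks_sq_le hmin hall hq hq', (zero_lt_one.trans_le hqx).ne'⟩

end Main

end AutNorm

theorem theorem2 {F : Type*} [Group F] [IsFreeGroup F] [Nontrivial F] (x : F) :
    (AutNorm.IsSeparable x ∧
      (∀ n : ℤ, AutNorm.primitiveNorm (x ^ n) ≤ 2) ∧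
      (∀ N : F → ℕ, AutNorm.IsAutNorm N → AutNorm.IsBoundedIn N x)) ∨
    (¬ AutNorm.IsSeparable x ∧
      AutNorm.IsUndistorted AutNorm.primitiveNorm x ∧
      (∀ N : F → ℕ, AutNorm.IsAutNorm N → AutNorm.IsUndistorted N x) ∧
      ∃ (ι : Type _) (B : FreeGroupBasis ι F) (q : F → ℝ),
        FreeGroup.IsCyclicallyReduced (AutNorm.reducedWord B x) ∧
        AutNorm.IsHomogenization (AutNorm.brooks B (x ^ 2)) q ∧
        AutNorm.IsHomogeneousQuasimorphism q ∧
        (∃ C : ℝ, ∀ p : F, AutNorm.IsPrimitive p → |q p| ≤ C) ∧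
        q x ≠ 0) := by
  by_cases hx : AutNorm.IsSeparable x
  · refine Or.inl ⟨hx, hx.primitiveNorm_zpow_le, fun N hN => ?_⟩
    obtain ⟨K, hK⟩ := hN.exists_le_mul AutNorm.isAutNorm_primitiveNorm
    exact hx.isBoundedIn_primitiveNorm.of_le_mul hK
  · obtain ⟨ι, B, q, hxB, hq, hq', ⟨C, hC⟩, hqx⟩ :=
      AutNorm.exists_isHomogeneousQuasimorphism_of_not_isSeparable hx
    have hund : AutNorm.IsUndistorted AutNorm.primitiveNorm x :=
      hq'.isUndistorted AutNorm.submonoidClosure_isPrimitive hC hqx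
    refine Or.inr ⟨hx, hund, fun N hN => ?_, ι, B, q, hxB, hq, hq', ⟨C, hC⟩, hqx⟩
    obtain ⟨K, hK⟩ := AutNorm.isAutNorm_primitiveNorm.exists_le_mul hN
    exact hund.of_le_mul hK
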